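/- **Model.** Let $V$ be a finite set of $n$ agents and let $K\ge n$ be a real constant. A strategy of agent $u$ is a finite set $S_u\subseteq (V\setminus\{u\})\times\mathbb Z$; $(v,l)\in S_u$ means that $u$ buys the edge $\{u,v\}$ with label $l$. A profile $\mathbf s=(S_u)_{u\in V}$ forms the temporal graph $G(\mathbf s)$ whose edges are the bought edges, each labelled with the least label bought for it by either endpoint. Let $R^{<}(u)$ be the set of vertices reachable from $u$ by walks in $G(\mathbf s)$ with strictly increasing edge labels (so $u\in R^{<}(u)$). In the proper-labeling model with strict paths the cost of $u$ is $$c(u,\mathbf s)=|S_u|+K\,|\{(v,l)\in S_u: l<1\}|+P^{\ne}(u)+K\,|V\setminus R^{<}(u)|,$$ where $P^{\ne}(u)$ is $K$ if $u$ buys edges to two different agents with the same label, and $0$ otherwise, plus another $K$ if $u$ buys an edge $\{u,v\}$ with some label $l$ while another agent $x\neq u$ buys, with the same label $l$, an edge $\{x,w\}$ having an endpoint in $\{u,v\}$. The social cost is $C(\mathbf s)=\sum_u c(u,\mathbf s)$. A profile is a Nash equilibrium if no agent can lower its cost by changing only its own strategy, and the price of stability $\mathrm{PoS}$ is the minimal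 social cost of a Nash equilibrium divided by the minimal social cost of any profile. **Ring profile** (for $n\ge 4$). Name the agents $v_a,v_b,v_c,v_d$ and $v_e^0,\dots,v_e^{n-5}$ in any order. Agent $v_a$ buys $\{v_a,v_b\}$ and $v_c$ buys $\{v_c,v_d\}$, both with label $n$; $v_b$ buys $\{v_b,v_c\}$ and $v_d$ buys $\{v_d,v_a\}$, both with label $n+1$. For even $k$, $v_e^k$ buys the edge to $v_a$ with label $\lfloor k/2\rfloor+1$ and $v_c$ buys the edge to $v_e^k$ with label $n+2+\lfloor k/2\rfloor$; for odd $k$ the same holds with $v_a$ and $v_c$ exchanged. **Theorem.** 1. If $n\ge4$, then for every naming of the agents the temporal graph of the ring profile is properly labelled (adjacent edges have different labels), every vertex reaches every vertex by a strict temporal path, and it has exactly $2n-4$ edges; the ring profile is a Nash equilibrium of the proper-labeling model with strict paths, and it minimizes the social cost among all profiles, with social cost $2n-4$. 2. For every $n$ there is a Nash equilibrium, and one of them minimizes the social cost among all profiles. 3. If $n\ge2$, every profile has positive social cost and $\mathrm{PoS}=1$. -/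

import Mathlib

namespace TemporalGame

/-- A temporal graph on `V`: an undirected graph with integer edge labels.
Only the values of `label` on edges of `graph` are ever used. -/
structure TemporalGraph (V : Type*) where
  graph : SimpleGraph V
  label : Sym2 V → ℤ

namespace TemporalGraph

variable {V : Type*}

/-- The labeling is proper: two distinct edges with a common endpoint have different labels. -/
def IsProper (G : TemporalGraph V) : Prop :=
  ∀ e ∈ G.graph.edgeSet, ∀ e' ∈ G.graph.edgeSet,
    e ≠ e' → (∃ v, v ∈ e ∧ v ∈ e') → G.label e ≠ G.label e'

/-- The set `R(u)` of vertices that are reached from `u` by a strict temporal path, that is, by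
consecutive edges with strictly increasing labels (the empty path reaches `u` itself). -/
def strictReach (G : TemporalGraph V) (u : V) : Set V :=
  {v | ∃ p : G.graph.Walk u v, (p.edges.map G.label).IsChain (· < ·)}

/-- Temporal connectivity with respect to strict temporal paths. -/
def IsTemporallyConnected (G : TemporalGraph V) : Prop :=
  ∀ u, G.strictReach u = Set.univ

end TemporalGraph

/-- A strategy of agent `u`: finitely many pairs `(v, l)` with `v ≠ u`, where `(v, l)` means that
`u` buys the edge `{u, v}` with label `l`. -/
def Strategy {V : Type*} (u : V) : Type _ :=
  {S : Finset (V × ℤ) // ∀ p ∈ S, p.1 ≠ u}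

/-- A strategy profile assigns a strategy to every agent. -/
abbrev Profile (V : Type*) : Type _ := ∀ u : V, Strategy u

section Game

variable {V : Type*}

/-- `Buys s u v l`: in the profile `s`, agent `u` buys the edge `{u, v}` with label `l`. -/
def Buys (s : Profile V) (u v : V) (l : ℤ) : Prop := (v, l) ∈ (s u).1

theorem Buys.ne {s : Profile V} {u v : V} {l : ℤ} (h : Buys s u v l) : v ≠ u :=
  (s u).2 (v, l) h

/-- All labels that are bought, by either endpoint, for the edge `e`. -/
def boughtLabels (s : Profile V) (e : Sym2 V) : Set ℤ :=
  {l | ∃ u v, s(u, v) = e ∧ Buys s u v l}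

/-- The temporal graph formed by the agents; the label of an edge is the least label bought
for it (see `isLeast_label`). -/
noncomputable def temporalGraph (s : Profile V) : TemporalGraph V where
  graph :=
    { Adj := fun u v => ∃ l, Buys s u v l ∨ Buys s v u l
      symm := ⟨fun _ _ ⟨l, h⟩ => ⟨l, h.symm⟩⟩
      loopless := ⟨fun _ ⟨_, h⟩ => h.elim (fun h => h.ne rfl) (fun h => h.ne rfl)⟩ }
  label := fun e => sInf (boughtLabels s e)

theorem isLeast_label [Finite V] (s : Profile V) {e : Sym2 V}
    (he : e ∈ (temporalGraph s).graph.edgeSet) :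
    IsLeast (boughtLabels s e) ((temporalGraph s).label e) := by
  have hne : (boughtLabels s e).Nonempty := by
    induction e with
    | _ u v =>
      obtain ⟨l, h | h⟩ := he
      · exact ⟨l, u, v, rfl, h⟩
      · exact ⟨l, v, u, Sym2.eq_swap, h⟩
  have hfin : (boughtLabels s e).Finite := by
    refine (Set.finite_iUnion (f := fun u : V => Prod.snd '' ((s u).1 : Set (V × ℤ)))
      fun u => ((s u).1.finite_toSet).image _).subset ?_
    rintro l ⟨u, v, -, h⟩
    exact Set.mem_iUnion.2 ⟨u, (v, l), h, rfl⟩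
  exact ⟨Int.csInf_mem hne hfin.bddBelow, fun l hl => csInf_le hfin.bddBelow hl⟩

/-- The uniform label cost: no label costs anything. -/
def labelCost (_s : Profile V) (_e : Sym2 V) : ℝ := 0

/-- Penalty for labels smaller than 1: `K` for each of them. -/
noncomputable def positivePenalty (K : ℝ) (s : Profile V) (u : V) : ℝ :=
  K * (((s u).1.filter fun p => p.2 < 1).card : ℝ)

open Classical in
/-- Penalty for violating proper labeling: `K` if `u` buys edges to two different agents with the
same label, plus `K` if `u` buys an edge `{u, v}` with a label `l` with which another agent `x`
buys an edge `{x, w}` that has an endpoint in `{u, v}`. -/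
noncomputable def properPenalty (K : ℝ) (s : Profile V) (u : V) : ℝ :=
  K * (if ∃ v w l, v ≠ w ∧ Buys s u v l ∧ Buys s u w l then 1 else 0) +
  K * (if ∃ v l, Buys s u v l ∧
        ∃ x w, x ≠ u ∧ Buys s x w l ∧ (x = v ∨ w = v ∨ w = u) then 1 else 0)

/-- The cost of agent `u`: number of bought edges, label costs, the two penalties, and `K` for
every agent that `u` does not reach by a strict temporal path. -/
noncomputable def cost (K : ℝ) (s : Profile V) (u : V) : ℝ :=
  ((s u).1.card : ℝ) + ∑ p ∈ (s u).1, labelCost s s(u, p.1)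
    + positivePenalty K s u + properPenalty K s u
    + K * (((temporalGraph s).strictReach u)ᶜ.ncard : ℝ)

/-- Nash equilibrium: no agent can lower its cost by a unilateral change of strategy. -/
def IsNash [DecidableEq V] (K : ℝ) (s : Profile V) : Prop :=
  ∀ (u : V) (S' : Strategy u), ¬ cost K (Function.update s u S') u < cost K s u

variable [Fintype V]

noncomputable def socialCost (K : ℝ) (s : Profile V) : ℝ := ∑ u, cost K s u

/-- A profile of minimal social cost. -/
def IsOptimal (K : ℝ) (s : Profile V) : Prop := ∀ s' : Profile V, socialCost K s ≤ socialCost K s'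

/-- The price of stability on the agent set `V`: the minimal social cost of a Nash equilibrium
divided by the minimal social cost of a profile. -/
noncomputable def priceOfStability (V : Type*) [Fintype V] [DecidableEq V] (K : ℝ) : ℝ :=
  sInf (socialCost K '' {s : Profile V | IsNash K s}) /
    sInf (Set.range (socialCost K : Profile V → ℝ))

end Game

section Construction

/-- `ringLabel n i j` is the label with which agent number `i` buys the edge to agent number `j`
in the ring profile on `n` agents (`none` if it does not buy it). Agents `0, 1, 2, 3` form the
ring; the other agents are `k + 4` with `0 ≤ k < n - 4`. -/
def ringLabel (n : ℕ) : ℕ → ℕ → Option ℤ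
  | 0, 1 => some n
  | 1, 2 => some (n + 1)
  | 2, 3 => some n
  | 3, 0 => some (n + 1)
  | k + 4, 0 => if Even k then some ((k / 2 + 1 : ℕ) : ℤ) else none
  | 2, k + 4 => if Even k then some ((n + 2 + k / 2 : ℕ) : ℤ) else none
  | k + 4, 2 => if Odd k then some ((k / 2 + 1 : ℕ) : ℤ) else none
  | 0, k + 4 => if Odd k then some ((n + 2 + k / 2 : ℕ) : ℤ) else none
  | _, _ => none

theorem ringLabel_self (n i : ℕ) : ringLabel n i i = none := by
  rcases i with _ | _ | _ | _ | i <;> rfl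

variable {V : Type*} [Fintype V] [DecidableEq V]

/-- The ring profile for a numbering of the agents by `0, …, n - 1`. -/
def ringProfile (num : V ≃ Fin (Fintype.card V)) : Profile V := fun u =>
  ⟨Finset.univ.biUnion fun v =>
      (ringLabel (Fintype.card V) (num u) (num v)).toFinset.image fun l => (v, l), by
    rintro ⟨v, l⟩ h rfl
    simp [ringLabel_self] at h⟩

theorem buys_ringProfile (num : V ≃ Fin (Fintype.card V)) (u v : V) (l : ℤ) :
    Buys (ringProfile num) u v l ↔
      ringLabel (Fintype.card V) (num u) (num v) = some l := by
  simp [Buys, ringProfile]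

end Construction

end TemporalGame

/-! The lower bound is the gossip theorem. Read the edges, in order of label, as telephone calls; a
strict temporal path is then a flow of information. One additional call for every pair (u, v) such
that u does not reach v lets everybody learn everything, so edges plus unreached pairs number at
least 2n - 4, and at least 2n - 3 for n ≤ 3 (`gossip`, `TemporalGraph.two_mul_card_le`). Every edge
is paid for and an unreached agent costs K ≥ 1, so the social cost obeys the same bounds.

`gossip` is an induction on the number of people. If somebody hears their own information, that
person can be replaced by the successive carriers of this information, which saves two calls
(`Flow.exists_contraction`). Otherwise, for each x, the calls that spread the information of x and
the calls that bring information to x number at least n - 1 each and overlap only in calls of x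
(`NoReturn.card_le`). With fewer than 2n - 4 calls, everybody makes at least three calls, some x
makes exactly three, and every call is useful for x. First calls are first for both partners, and
last calls likewise, so there are at least n/2 of each; the remaining calls, with the first and last
call of x, still connect everybody, but are too few (`NoReturn.two_mul_card_le`).

In the ring profile every outer agent first calls one hub, the four ring agents exchange everything
at times n and n + 1, and the other hub calls the outer agent back. This attains 2n - 4. As K ≥ n
bounds the cost of each agent, a profitable deviation is free of penalties, reaches everybody and
has fewer edges (`isNash_of_forall`). An agent with one purchase would have to buy nothing and would
lose somebody. A hub cannot take a shortcut through an early purchase, because the outer agents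
already occupy the early labels at both hubs (`HubDeviation.card_le`). For n ≤ 3 a suitably labelled
complete graph does the same job. -/

namespace TemporalGame

/-! ### Information flow along a sequence of calls -/

/-- `Flow c s u t v`: with calls `c r` at the times `r` (a diagonal element of `Sym2 V` means that
nobody calls), information that `u` has at time `s` can be at `v` at time `t`. -/
inductive Flow {V : Type*} (c : ℕ → Sym2 V) (s : ℕ) (u : V) : ℕ → V → Prop
  | refl : Flow c s u s u
  | stay {t : ℕ} {v : V} : Flow c s u t v → Flow c s u (t + 1) v
  | move {t : ℕ} {v w : V} : Flow c s u t v → c t = s(v, w) → Flow c s u (t + 1) w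

namespace Flow

variable {V : Type*} {c : ℕ → Sym2 V} {s t r m : ℕ} {u v w a : V}

theorem le (h : Flow c s u t v) : s ≤ t := by
  induction h with
  | refl => exact le_rfl
  | stay _ ih => omega
  | move _ _ ih => omega

theorem trans (h : Flow c s u t v) (h' : Flow c t v r w) : Flow c s u r w := by
  induction h' with
  | refl => exact h
  | stay _ ih => exact ih.stay
  | move _ hc ih => exact ih.move hc

theorem idle (u : V) (h : s ≤ t) : Flow c s u t u := by
  induction t, h using Nat.le_induction with
  | base => exact refl
  | succ t _ ih => exact ih.stay

theorem mono (h : Flow c s u t v) (hr : r ≤ s) (hm : t ≤ m) : Flow c r u m v :=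
  ((idle u hr).trans h).trans (idle v hm)

theorem single (h : c t = s(u, v)) : Flow c t u (t + 1) v := refl.move h

/-- The constructors extend a flow at its end; arguments that look backwards in time need the
induction at its start. -/
theorem head_induction {P : ℕ → V → Prop} (h : Flow c s u t v) (h0 : P t v)
    (h1 : ∀ r x, Flow c (r + 1) x t v → P (r + 1) x → P r x)
    (h2 : ∀ r x y, c r = s(x, y) → Flow c (r + 1) y t v → P (r + 1) y → P r x) : P s u := by
  induction h with
  | refl => exact h0
  | @stay t v h ih =>
    refine ih (h1 _ _ refl h0) (fun r x h => h1 r x h.stay) fun r x y hc h => h2 r x y hc h.stay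
  | @move t v w h hc ih =>
    exact ih (h2 _ _ _ hc refl h0) (fun r x h => h1 r x (h.move hc))
      fun r x y hc' h => h2 r x y hc' (h.move hc)

theorem tail_cases (h : Flow c s u (t + 1) v) (hst : s ≤ t) :
    Flow c s u t v ∨ ∃ w, c t = s(w, v) ∧ Flow c s u t w := by
  rcases h with _ | h | ⟨h, hc⟩
  · omega
  · exact Or.inl h
  · exact Or.inr ⟨_, hc, h⟩

theorem head_cases (h : Flow c s u t v) (hst : s < t) :
    Flow c (s + 1) u t v ∨ ∃ w, c s = s(u, w) ∧ Flow c (s + 1) w t v := by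
  have key : s = t ∧ u = v ∨ Flow c (s + 1) u t v ∨ ∃ w, c s = s(u, w) ∧ Flow c (s + 1) w t v :=
    h.head_induction (P := fun s u => s = t ∧ u = v ∨ Flow c (s + 1) u t v ∨
      ∃ w, c s = s(u, w) ∧ Flow c (s + 1) w t v) (Or.inl ⟨rfl, rfl⟩)
      (fun r x h _ => Or.inr (Or.inl h)) (fun r x y hc h _ => Or.inr (Or.inr ⟨y, hc, h⟩))
  rcases key with h' | h'
  · omega
  · exact h'

/-- Information that leaves `u` does so in a first call. -/
theorem exists_first_call (h : Flow c s u t v) (huv : u ≠ v) :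
    ∃ r w, s ≤ r ∧ r < t ∧ w ≠ u ∧ c r = s(u, w) ∧ Flow c (r + 1) w t v := by
  induction h with
  | refl => exact absurd rfl huv
  | stay h ih =>
    obtain ⟨r, w, h1, h2, h3, h4, h5⟩ := ih huv
    exact ⟨r, w, h1, by omega, h3, h4, h5.stay⟩
  | @move t v w h hc ih =>
    by_cases hv : u = v
    · subst hv
      exact ⟨t, w, h.le, by omega, huv.symm, hc, refl⟩
    · obtain ⟨r, x, h1, h2, h3, h4, h5⟩ := ih hv
      exact ⟨r, x, h1, by omega, h3, h4, h5.move hc⟩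

/-- Information does not leave `u` while `u` makes no call. -/
theorem of_no_call_start (h : Flow c s u t v) (hst : s ≤ r) (hrt : r ≤ t)
    (hno : ∀ q, s ≤ q → q < r → u ∈ c q → (c q).IsDiag) : Flow c r u t v := by
  induction r, hst using Nat.le_induction with
  | base => exact h
  | succ q hq ih =>
    have h' := ih (by omega) fun p h1 h2 => hno p h1 (by omega)
    rcases h'.head_cases (by omega) with h' | ⟨w, hc, h'⟩
    · exact h'
    · have hd := hno q hq (by omega) (by simp [hc])
      rw [hc, Sym2.mk_isDiag_iff] at hd
      rwa [hd]

/-- Information does not reach `v` while `v` makes no call. -/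
theorem of_no_call_end (h : Flow c s u t v) (hst : s ≤ r) (hrt : r ≤ t)
    (hno : ∀ q, r ≤ q → q < t → v ∈ c q → (c q).IsDiag) : Flow c s u r v := by
  induction h with
  | refl => obtain rfl : r = s := by omega
            exact refl
  | @stay t v h ih =>
    rcases Nat.lt_or_ge t r with h' | h'
    · obtain rfl : r = t + 1 := by omega
      exact h.stay
    · exact ih h' fun q h1 h2 => hno q h1 (by omega)
  | @move t v w h hc ih =>
    rcases Nat.lt_or_ge t r with h' | h'
    · obtain rfl : r = t + 1 := by omega
      exact h.move hc
    · have hd := hno t h' (by omega) (by simp [hc])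
      rw [hc, Sym2.mk_isDiag_iff] at hd
      subst hd
      exact ih h' fun q h1 h2 => hno q h1 (by omega)

end Flow

/-! ### Removing a person who hears their own information -/

section Contraction

variable {V : Type*} {c : ℕ → Sym2 V}

/-- A route of the information of `x` along vertices different from `a`, up to the first time that
it is told to `a` (if ever). -/
theorem Flow.exists_carrier {S : Finset V} (hS : ∀ t, ∀ v ∈ c t, v ∈ S) {s t : ℕ} {x v a : V}
    (h : Flow c s x t v) (hxa : x ≠ a) (hx : x ∈ S) :
    ∃ κ : ℕ → V, (∀ r ≤ s, κ r = x) ∧ (∀ r, κ r ≠ a) ∧ (∀ r, κ r ∈ S) ∧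
      (∀ r, κ (r + 1) = κ r ∨ c r = s(κ r, κ (r + 1))) ∧
      ((∀ r, t ≤ r → κ r = v) ∨ ∃ q, s ≤ q ∧ q < t ∧ c q = s(a, κ q)) := by
  induction h with
  | refl => exact ⟨fun _ => x, by simp, by simp [hxa], by simp [hx], by simp, by simp⟩
  | @stay t v h ih =>
    obtain ⟨κ, h1, h2, h3, h4, h5 | h5⟩ := ih
    · exact ⟨κ, h1, h2, h3, h4, Or.inl fun r hr => h5 r (by omega)⟩
    · obtain ⟨q, hq1, hq2, hq3⟩ := h5
      exact ⟨κ, h1, h2, h3, h4, Or.inr ⟨q, hq1, by omega, hq3⟩⟩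
  | @move t v w h hc ih =>
    obtain ⟨κ, h1, h2, h3, h4, h5 | h5⟩ := ih
    · by_cases hw : w = a
      · subst hw
        refine ⟨κ, h1, h2, h3, h4, Or.inr ⟨t, h.le, by omega, ?_⟩⟩
        rw [h5 t le_rfl, hc, Sym2.eq_swap]
      · have hwS : w ∈ S := hS t w (by simp [hc])
        have hle := h.le
        refine ⟨fun r => if r ≤ t then κ r else w, fun r hr => ?_, fun r => ?_, fun r => ?_,
          fun r => ?_, Or.inl fun r hr => ?_⟩
        · simp [h1 r hr, hr.trans hle]
        · dsimp only; split_ifs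
          · exact h2 r
          · exact hw
        · dsimp only; split_ifs
          · exact h3 r
          · exact hwS
        · rcases lt_trichotomy r t with hr | rfl | hr
          · simpa [hr.le, Nat.succ_le_of_lt hr] using h4 r
          · right; simp [h5 r le_rfl, hc]
          · left; simp [hr.not_ge, (Nat.lt_succ_of_lt hr).not_ge]
        · simp [show ¬ r ≤ t by omega]
    · obtain ⟨q, hq1, hq2, hq3⟩ := h5
      exact ⟨κ, h1, h2, h3, h4, Or.inr ⟨q, hq1, by omega, hq3⟩⟩

/-- If the person `a` is replaced by the successive carriers `κ`, information still flows. -/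
theorem Flow.contract [DecidableEq V] {κ : ℕ → V} {a : V} (h2 : ∀ r, κ r ≠ a)
    (h4 : ∀ r, κ (r + 1) = κ r ∨ c r = s(κ r, κ (r + 1))) {s t : ℕ} {u v : V} (h : Flow c s u t v)
    (hu : u ≠ a) :
    Flow (fun r => (c r).map fun x => if x = a then κ r else x) s u t
      (if v = a then κ t else v) := by
  induction h with
  | refl => simpa [hu] using Flow.refl
  | @stay t v h ih =>
    by_cases hv : v = a
    · simp only [hv, if_true] at ih ⊢
      rcases h4 t with h | h
      · rw [h]; exact ih.stay
      · refine ih.move ?_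
        simp [h, h2]
    · simp only [hv, if_false] at ih ⊢
      exact ih.stay
  | @move t v w h hc ih =>
    have hm := ih.move (w := if w = a then κ t else w) (by simp [hc])
    by_cases hw : w = a
    · simp only [hw, if_true] at hm ⊢
      rcases h4 t with h | h
      · rw [h]; exact hm
      -- The carriers are never `a`, so a call that passes the information from one carrier to the
      -- next does not involve `a`.
      · exfalso
        have : a ∈ c t := by simp [hc, hw]
        rw [h, Sym2.mem_iff] at this
        rcases this with h | h
        · exact h2 _ h.symm
        · exact h2 _ h.symm
    · simpa [hw] using hm

open Classical in
/-- The times before `m` of the actual calls. -/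
noncomputable def callTimes (c : ℕ → Sym2 V) (m : ℕ) : Finset ℕ := (Finset.range m).filter fun t => ¬ (c t).IsDiag

theorem mem_callTimes {m t : ℕ} : t ∈ callTimes c m ↔ t < m ∧ ¬ (c t).IsDiag := by
  simp [callTimes]

/-- The carriers follow the information of `x` from the call with `a` at time `t` until it is told
to `a` at a time `q > t`. Once they replace `a`, both of these calls become diagonal, while the
flows among the other people survive. -/
theorem Flow.exists_contraction [DecidableEq V] {S : Finset V} (hS : ∀ t, ∀ v ∈ c t, v ∈ S) {m : ℕ}
    (hall : ∀ u ∈ S, ∀ v ∈ S, Flow c 0 u m v) {t : ℕ} (ht : t < m) {a x : V} (hc : c t = s(a, x))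
    (hxa : x ≠ a) (h : Flow c (t + 1) x m a) :
    ∃ c' : ℕ → Sym2 V, (∀ t, ∀ v ∈ c' t, v ∈ S.erase a) ∧
      (∀ u ∈ S.erase a, ∀ v ∈ S.erase a, Flow c' 0 u m v) ∧
      (callTimes c' m).card + 2 ≤ (callTimes c m).card := by
  obtain ⟨κ, h1, h2, h3, h4, h5⟩ := h.exists_carrier hS hxa (hS t x (by simp [hc]))
  have h5 : ∃ q, t < q ∧ q < m ∧ c q = s(a, κ q) := by
    rcases h5 with h5 | ⟨q, hq, hqm, h5⟩
    · exact absurd (h5 m le_rfl) (h2 m)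
    · exact ⟨q, by omega, hqm, h5⟩
  obtain ⟨q, htq, hqm, hq⟩ := h5
  refine ⟨fun r => (c r).map fun x => if x = a then κ r else x, fun r v hv => ?_,
    fun u hu v hv => ?_, ?_⟩
  · rw [Sym2.mem_map] at hv
    obtain ⟨w, hw, rfl⟩ := hv
    split_ifs with h
    · simp [h2, h3]
    · simp [h, hS r w hw]
  · rw [Finset.mem_erase] at hu hv
    simpa [hv.1] using (hall u hu.2 v hv.2).contract h2 h4 hu.1
  · have hsub : callTimes (fun r => (c r).map fun x => if x = a then κ r else x) m ⊆
        ((callTimes c m).erase t).erase q := by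
      intro r hr
      rw [mem_callTimes] at hr
      rw [Finset.mem_erase, Finset.mem_erase, mem_callTimes]
      refine ⟨?_, ?_, hr.1, fun hd => hr.2 ?_⟩
      · rintro rfl
        exact hr.2 (by simp [hq, h2])
      · rintro rfl
        exact hr.2 (by simp [hc, hxa, h1 r (by omega)])
      · revert hd
        generalize c r = e
        induction e with
        | _ y z => rintro h; obtain rfl : y = z := h; simp
    have hle := Finset.card_le_card hsub
    have ht' : t ∈ callTimes c m := mem_callTimes.2 ⟨ht, by simp [hc, hxa.symm]⟩
    have hq' : q ∈ (callTimes c m).erase t :=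
      Finset.mem_erase.2 ⟨by omega, mem_callTimes.2 ⟨hqm, by simp [hq, (h2 q).symm]⟩⟩
    have e1 := Finset.card_erase_add_one hq'
    have e2 := Finset.card_erase_add_one ht'
    omega

end Contraction

/-! ### Counting calls when nobody hears their own information -/

section Counting

variable {V : Type*} {c : ℕ → Sym2 V} {m : ℕ}

/-- Nobody hears their own information. -/
def NoReturn (c : ℕ → Sym2 V) (m : ℕ) : Prop :=
  ∀ t a x, t < m → c t = s(a, x) → x ≠ a → ¬ Flow c (t + 1) x m a

/-- Information that gets from `x` to `v` leaves `x` in some first call; coming back from `v`, it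
would return to `x` after that call. -/
theorem NoReturn.not_flow (hno : NoReturn c m) {s t : ℕ} {x v : V} (hv : x ≠ v)
    (h : Flow c s x t v) : ¬ Flow c t v m x := fun h' => by
  obtain ⟨r, w, -, hrt, hw, hc, h1⟩ := h.exists_first_call hv
  have := h'.le
  exact hno r x w (by omega) hc hw (h1.trans h')

open Classical in
/-- The times before `t` at which the information of `x` is told to somebody new. -/
noncomputable def outTimes (c : ℕ → Sym2 V) (x : V) (t : ℕ) : Finset ℕ :=
  (Finset.range t).filter fun r => ∃ p q, c r = s(p, q) ∧ Flow c 0 x r p ∧ ¬ Flow c 0 x r q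

open Classical in
/-- The times from `s` on of the calls that bring somebody's information to `x`, looking backwards
in time. -/
noncomputable def inTimes (c : ℕ → Sym2 V) (m : ℕ) (x : V) (s : ℕ) : Finset ℕ :=
  (Finset.Ico s m).filter fun r =>
    ∃ p q, c r = s(p, q) ∧ Flow c (r + 1) p m x ∧ ¬ Flow c (r + 1) q m x

open Classical in
-- Before time 0 only `x` is informed, and a call adds at most one person.
theorem card_informed_le (c : ℕ → Sym2 V) (S : Finset V) (x : V) (t : ℕ) :
    (S.filter fun v => Flow c 0 x t v).card ≤ (outTimes c x t).card + 1 := by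
  induction t with
  | zero =>
    refine (Finset.card_le_one.2 fun a ha b hb => ?_).trans (by omega)
    have key : ∀ v, Flow c 0 x 0 v → v = x := fun v h => by cases h; rfl
    rw [key a (Finset.mem_filter.1 ha).2, key b (Finset.mem_filter.1 hb).2]
  | succ t ih =>
    have hs : outTimes c x (t + 1) = (Finset.range (t + 1)).filter fun r =>
      ∃ p q, c r = s(p, q) ∧ Flow c 0 x r p ∧ ¬ Flow c 0 x r q := rfl
    rw [Finset.range_add_one, Finset.filter_insert] at hs
    split_ifs at hs with h
    · rw [hs, Finset.card_insert_of_notMem (by simp)]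
      obtain ⟨p, q, hc, hp, hq⟩ := h
      refine (Finset.card_le_card (t := insert q (S.filter fun v => Flow c 0 x t v)) ?_).trans
        ((Finset.card_insert_le _ _).trans (Nat.succ_le_succ ih))
      intro v hv
      rw [Finset.mem_filter] at hv
      rw [Finset.mem_insert, Finset.mem_filter]
      rcases hv.2.tail_cases (Nat.zero_le t) with h | ⟨w, hc', -⟩
      · exact Or.inr ⟨hv.1, h⟩
      · rw [hc, Sym2.eq_iff] at hc'
        rcases hc' with ⟨rfl, rfl⟩ | ⟨rfl, rfl⟩
        · exact Or.inl rfl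
        · exact Or.inr ⟨hv.1, hp⟩
    · rw [hs]
      refine (Finset.card_le_card ?_).trans ih
      intro v hv
      rw [Finset.mem_filter] at hv ⊢
      refine ⟨hv.1, ?_⟩
      rcases hv.2.tail_cases (Nat.zero_le t) with h' | ⟨w, hc', h'⟩
      · exact h'
      · by_contra hq
        exact h ⟨w, v, hc', h', hq⟩

open Classical in
-- This is `card_informed_le` with time reversed.
theorem card_informing_le (c : ℕ → Sym2 V) (m : ℕ) (S : Finset V) (x : V) (s : ℕ) (hs : s ≤ m) :
    (S.filter fun v => Flow c s v m x).card ≤ (inTimes c m x s).card + 1 := by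
  induction hs using Nat.decreasingInduction with
  | self =>
    refine (Finset.card_le_one.2 fun a ha b hb => ?_).trans (by omega)
    have key : ∀ v, Flow c m v m x → v = x := fun v h => by
      by_contra hv
      obtain ⟨r, w, h1, h2, -⟩ := h.exists_first_call hv
      omega
    rw [key a (Finset.mem_filter.1 ha).2, key b (Finset.mem_filter.1 hb).2]
  | of_succ s hsm ih =>
    have hs : inTimes c m x s = (Finset.Ico s m).filter fun r =>
      ∃ p q, c r = s(p, q) ∧ Flow c (r + 1) p m x ∧ ¬ Flow c (r + 1) q m x := rfl
    rw [show Finset.Ico s m = insert s (Finset.Ico (s + 1) m) by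
      ext; simp only [Finset.mem_insert, Finset.mem_Ico]; omega, Finset.filter_insert] at hs
    split_ifs at hs with h
    · rw [hs, Finset.card_insert_of_notMem (by simp)]
      obtain ⟨p, q, hc, hp, hq⟩ := h
      refine (Finset.card_le_card (t := insert q (S.filter fun v => Flow c (s + 1) v m x)) ?_).trans
        ((Finset.card_insert_le _ _).trans (Nat.succ_le_succ ih))
      intro v hv
      rw [Finset.mem_filter] at hv
      rw [Finset.mem_insert, Finset.mem_filter]
      rcases hv.2.head_cases hsm with h | ⟨w, hc', h⟩
      · exact Or.inr ⟨hv.1, h⟩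
      · rw [hc, Sym2.eq_iff] at hc'
        rcases hc' with ⟨rfl, rfl⟩ | ⟨rfl, rfl⟩
        · exact Or.inr ⟨hv.1, hp⟩
        · exact Or.inl rfl
    · rw [hs]
      refine (Finset.card_le_card ?_).trans ih
      intro v hv
      rw [Finset.mem_filter] at hv ⊢
      refine ⟨hv.1, ?_⟩
      rcases hv.2.head_cases hsm with h' | ⟨w, hc', h'⟩
      · exact h'
      · by_contra hq
        exact h ⟨w, v, hc'.trans Sym2.eq_swap, h', hq⟩

open Classical in
/-- The times of the calls of `x`. -/
noncomputable def callTimesOf (c : ℕ → Sym2 V) (m : ℕ) (x : V) : Finset ℕ := (callTimes c m).filter fun t => x ∈ c t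

open Classical in
theorem mem_callTimesOf {t : ℕ} {x : V} :
    t ∈ callTimesOf c m x ↔ (t < m ∧ ¬ (c t).IsDiag) ∧ x ∈ c t := by
  rw [callTimesOf, Finset.mem_filter, mem_callTimes]

theorem mem_outTimes {t : ℕ} {x : V} : t ∈ outTimes c x m ↔
    t < m ∧ ∃ p q, c t = s(p, q) ∧ Flow c 0 x t p ∧ ¬ Flow c 0 x t q := by
  classical
  rw [outTimes, Finset.mem_filter, Finset.mem_range]

theorem mem_inTimes {t : ℕ} {x : V} : t ∈ inTimes c m x 0 ↔
    t < m ∧ ∃ p q, c t = s(p, q) ∧ Flow c (t + 1) p m x ∧ ¬ Flow c (t + 1) q m x := by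
  classical
  rw [inTimes, Finset.mem_filter, Finset.mem_Ico]
  simp

theorem outTimes_union_inTimes_subset (x : V) :
    outTimes c x m ∪ inTimes c m x 0 ⊆ callTimes c m := by
  intro t ht
  rw [Finset.mem_union, mem_outTimes, mem_inTimes] at ht
  rw [mem_callTimes]
  rcases ht with ⟨ht, p, q, hc, hp, hq⟩ | ⟨ht, p, q, hc, hp, hq⟩ <;>
  · refine ⟨ht, fun hd => hq ?_⟩
    rw [hc, Sym2.mk_isDiag_iff] at hd
    rwa [← hd]

/-- By `NoReturn`, a call that both spreads the information of `x` and brings information to `x` is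
a call of `x`. -/
theorem NoReturn.inter_subset (hno : NoReturn c m) (x : V) :
    outTimes c x m ∩ inTimes c m x 0 ⊆ callTimesOf c m x := by
  intro t ht
  have ht' := outTimes_union_inTimes_subset x (Finset.mem_union_left _ (Finset.mem_inter.1 ht).1)
  classical
  rw [callTimesOf, Finset.mem_filter]
  refine ⟨ht', ?_⟩
  rw [Finset.mem_inter, mem_outTimes, mem_inTimes] at ht
  obtain ⟨⟨htm, p, q, hc, hp, hq⟩, -, p', q', hc', hp', -⟩ := ht
  have h1 : Flow c 0 x (t + 1) p' := by
    have : p' = p ∨ p' = q := by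
      have h : p' ∈ c t := by simp [hc']
      simpa [hc] using h
    rcases this with rfl | rfl
    · exact hp.stay
    · exact hp.move hc
  by_contra hx
  refine hno.not_flow ?_ h1 hp'
  rintro rfl
  exact hx (by simp [hc'])

/-- Both sets of times have at least `S.card - 1` elements, and `NoReturn.inter_subset` bounds their
intersection by the calls of `x`. -/
theorem NoReturn.card_le (hno : NoReturn c m) {S : Finset V}
    (hall : ∀ u ∈ S, ∀ v ∈ S, Flow c 0 u m v) {x : V} (hx : x ∈ S) :
    2 * S.card ≤ (outTimes c x m ∪ inTimes c m x 0).card + (callTimesOf c m x).card + 2 := by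
  classical
  have h1 := card_informed_le c S x m
  have h2 := card_informing_le c m S x 0 (Nat.zero_le m)
  rw [Finset.filter_true_of_mem fun v hv => hall x hx v hv] at h1
  rw [Finset.filter_true_of_mem fun v hv => hall v hv x hx] at h2
  have h3 := Finset.card_union_add_card_inter (outTimes c x m) (inTimes c m x 0)
  have h4 := Finset.card_le_card (hno.inter_subset x)
  omega

theorem sum_card_callTimesOf {S : Finset V} (hS : ∀ t, ∀ v ∈ c t, v ∈ S) :
    ∑ x ∈ S, (callTimesOf c m x).card = 2 * (callTimes c m).card := by
  classical
  have h := Finset.sum_card_bipartiteAbove_eq_sum_card_bipartiteBelow (s := S) (t := callTimes c m)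
    (fun x t => x ∈ c t)
  rw [Finset.sum_const_nat (m := 2) (s := callTimes c m)] at h
  · rw [mul_comm, ← h]; rfl
  · intro t ht
    have hd := (mem_callTimes.1 ht).2
    have hSt := hS t
    rw [Finset.bipartiteBelow]
    revert hd hSt
    generalize c t = e
    induction e with
    | _ y z =>
      intro hd hSt
      rw [Finset.card_eq_two]
      refine ⟨y, z, hd, ?_⟩
      ext v
      simp only [Finset.mem_filter, Sym2.mem_iff, Finset.mem_insert, Finset.mem_singleton]
      exact ⟨fun h => h.2, fun h => ⟨hSt v (by simpa using h), h⟩⟩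

/-- A first call is the first call of both partners. -/
theorem NoReturn.first_call (hno : NoReturn c m) {S : Finset V} (hS : ∀ t, ∀ v ∈ c t, v ∈ S)
    (hall : ∀ u ∈ S, ∀ v ∈ S, Flow c 0 u m v) {t : ℕ} (htm : t < m) {v w : V} (hc : c t = s(v, w))
    (hfirst : ∀ q < t, v ∈ c q → (c q).IsDiag) : ∀ q < t, w ∈ c q → (c q).IsDiag := by
  intro q hq hw
  obtain ⟨z, hz⟩ := hw
  rw [hz, Sym2.mk_isDiag_iff]
  by_contra hwz
  have h1 : Flow c t v m z := (hall v (hS t v (by simp [hc])) z (hS q z (by simp [hz]))).of_no_call_start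
    (Nat.zero_le t) htm.le fun r _ hr => hfirst r hr
  -- The call at `t` makes `v` and `w` interchangeable as sources. So what `z` told `w` at the
  -- earlier time `q` would return to `z`.
  have h2 : Flow c t w m z := by
    rcases h1.head_cases htm with h | ⟨w', hc', h⟩
    · exact (Flow.single (hc.trans Sym2.eq_swap)).trans h
    · obtain rfl : w = w' := Sym2.congr_right.1 (hc.symm.trans hc')
      exact h.mono (Nat.le_succ t) le_rfl
  exact hno q z w (by omega) (hz.trans Sym2.eq_swap) hwz (h2.mono (by omega) le_rfl)

/-- A last call is the last call of both partners. -/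
theorem NoReturn.last_call (hno : NoReturn c m) {S : Finset V} (hS : ∀ t, ∀ v ∈ c t, v ∈ S)
    (hall : ∀ u ∈ S, ∀ v ∈ S, Flow c 0 u m v) {t : ℕ} {v w : V} (hc : c t = s(v, w))
    (hlast : ∀ q, t < q → q < m → v ∈ c q → (c q).IsDiag) :
    ∀ q, t < q → q < m → w ∈ c q → (c q).IsDiag := by
  intro q hq hqm hw
  obtain ⟨z, hz⟩ := hw
  rw [hz, Sym2.mk_isDiag_iff]
  by_contra hwz
  have h1 : Flow c 0 z (t + 1) v :=
    (hall z (hS q z (by simp [hz])) v (hS t v (by simp [hc]))).of_no_call_end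
      (Nat.zero_le _) (by omega) fun r hr => hlast r hr
  -- After the call at `t`, `w` knows what `v` knows, in particular the information of `z`; the
  -- later call of `w` with `z` would return it.
  have h2 : Flow c 0 z (t + 1) w := by
    rcases h1.tail_cases (Nat.zero_le t) with h | ⟨w', hc', h⟩
    · exact h.move hc
    · obtain rfl : w' = w := (Sym2.congr_left.1 (hc'.symm.trans (hc.trans Sym2.eq_swap)))
      exact h.stay
  exact hno.not_flow (Ne.symm hwz) (h2.mono le_rfl hq)
    ((Flow.single hz).mono le_rfl hqm)

end Counting

/-! ### The gossip theorem -/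

section Gossip

variable {V : Type*} {c : ℕ → Sym2 V} {m : ℕ}

/-- A connected graph has at least as many edges as a spanning tree, and distinct edges come from
distinct calls. -/
theorem card_le_of_connected_calls (c : ℕ → Sym2 V) (T : Finset ℕ) (S : Finset V)
    (G : SimpleGraph S) (hG : G.Connected)
    (hGT : ∀ p q, G.Adj p q → ∃ t ∈ T, c t = s(p.1, q.1)) : S.card ≤ T.card + 1 := by
  have h := hG.card_vert_le_card_edgeSet_add_one
  have hex : ∀ e : G.edgeSet, ∃ t : T, c t = Sym2.map Subtype.val e.1 := by
    rintro ⟨e, he⟩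
    induction e with
    | _ p q =>
      obtain ⟨t, ht, h⟩ := hGT p q he
      exact ⟨⟨t, ht⟩, h⟩
  choose f hf using hex
  have hinj : Function.Injective f := fun e e' h => by
    apply Subtype.ext
    apply Sym2.map.injective Subtype.val_injective
    rw [← hf, ← hf, h]
  have := Nat.card_le_card_of_injective f hinj
  simp only [Nat.card_eq_fintype_card, Fintype.card_coe] at this h
  omega

theorem card_le_two_mul_card_image {S : Finset V} {F : V → ℕ} (hF : ∀ v ∈ S, v ∈ c (F v)) :
    S.card ≤ 2 * (S.image F).card := by
  classical
  refine Finset.card_le_mul_card_image S 2 fun t _ => ?_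
  obtain ⟨y, z, h⟩ : ∃ y z, c t = s(y, z) := by
    generalize c t = e
    induction e with
    | _ y z => exact ⟨y, z, rfl⟩
  refine (Finset.card_le_card (t := {y, z}) fun v hv => ?_).trans Finset.card_le_two
  rw [Finset.mem_filter] at hv
  obtain ⟨hv, rfl⟩ := hv
  simpa [h] using hF v hv

theorem NoReturn.two_mul_card_le (hno : NoReturn c m) {S : Finset V}
    (hS : ∀ t, ∀ v ∈ c t, v ∈ S) (hall : ∀ u ∈ S, ∀ v ∈ S, Flow c 0 u m v)
    (hdeg : ∀ x ∈ S, 3 ≤ (callTimesOf c m x).card) :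
    2 * S.card ≤ (callTimes c m).card + 4 := by
  classical
  by_contra! hlt
  -- If everybody made four calls, there would be at least `2 * S.card` calls in all.
  obtain ⟨x, hx, hx3⟩ : ∃ x ∈ S, (callTimesOf c m x).card ≤ 3 := by
    by_contra! h
    have h1 := Finset.card_nsmul_le_sum S (fun x => (callTimesOf c m x).card) 4 h
    rw [sum_card_callTimesOf hS, smul_eq_mul] at h1
    omega
  -- With three calls of `x`, `NoReturn.card_le` yields `2 * S.card - 5` useful calls, which by
  -- assumption is all of them.
  have huse : outTimes c x m ∪ inTimes c m x 0 = callTimes c m := by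
    refine Finset.eq_of_subset_of_card_le (outTimes_union_inTimes_subset x) ?_
    have := hno.card_le hall hx
    omega
  have hpos : ∀ v ∈ S, (callTimesOf c m v).Nonempty := fun v hv =>
    Finset.card_pos.1 (by have := hdeg v hv; omega)
  have hexF : ∀ v ∈ S, ∃ t ∈ callTimesOf c m v, ∀ q ∈ callTimesOf c m v, t ≤ q := fun v hv =>
    Finset.exists_min_image _ id (hpos v hv)
  have hexL : ∀ v ∈ S, ∃ t ∈ callTimesOf c m v, ∀ q ∈ callTimesOf c m v, q ≤ t := fun v hv =>
    Finset.exists_max_image _ id (hpos v hv)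
  choose! F hF hFmin using hexF
  choose! L hL hLmax using hexL
  have hFF : ∀ v ∈ S, ∀ w ∈ c (F v), F w = F v := by
    intro v hv w hw
    have hwS := hS _ w hw
    have hFv := mem_callTimesOf.1 (hF v hv)
    refine le_antisymm (hFmin w hwS _ (mem_callTimesOf.2 ⟨hFv.1, hw⟩)) ?_
    by_contra! hlt
    rcases eq_or_ne v w with rfl | hvw
    · exact lt_irrefl _ hlt
    have hFw := mem_callTimesOf.1 (hF w hwS)
    refine hFw.1.2 (hno.first_call hS hall hFv.1.1 ((Sym2.mem_and_mem_iff hvw).1 ⟨hFv.2, hw⟩)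
      (fun q hq hvq => ?_) _ hlt hFw.2)
    by_contra hd
    have := hFmin v hv q (mem_callTimesOf.2 ⟨⟨by omega, hd⟩, hvq⟩)
    omega
  have hLL : ∀ v ∈ S, ∀ w ∈ c (L v), L w = L v := by
    intro v hv w hw
    have hwS := hS _ w hw
    have hLv := mem_callTimesOf.1 (hL v hv)
    refine le_antisymm ?_ (hLmax w hwS _ (mem_callTimesOf.2 ⟨hLv.1, hw⟩))
    by_contra! hlt
    rcases eq_or_ne v w with rfl | hvw
    · exact lt_irrefl _ hlt
    have hLw := mem_callTimesOf.1 (hL w hwS)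
    refine hLw.1.2 (hno.last_call hS hall ((Sym2.mem_and_mem_iff hvw).1 ⟨hLv.2, hw⟩)
      (fun q hq hqm hvq => ?_) _ hlt hLw.1.1 hLw.2)
    by_contra hd
    have := hLmax v hv q (mem_callTimesOf.2 ⟨⟨hqm, hd⟩, hvq⟩)
    omega
  have hFL : ∀ v ∈ S, F v ≠ L v := by
    intro v hv h
    have : (callTimesOf c m v).card ≤ 1 := Finset.card_le_one.2 fun a ha b hb => by
      have := hFmin v hv a ha
      have := hLmax v hv a ha
      have := hFmin v hv b hb
      have := hLmax v hv b hb
      omega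
    have := hdeg v hv
    omega
  have hdisj : Disjoint (S.image F) (S.image L) := by
    rw [Finset.disjoint_left]
    intro t ht ht'
    obtain ⟨v, hv, rfl⟩ := Finset.mem_image.1 ht
    obtain ⟨w, hw, h⟩ := Finset.mem_image.1 ht'
    have := hFF v hv w (h ▸ (mem_callTimesOf.1 (hL w hw)).2)
    exact hFL w hw (this.trans h.symm)
  have hsub : S.image F ∪ S.image L ⊆ callTimes c m := by
    refine Finset.union_subset ?_ ?_ <;> refine Finset.image_subset_iff.2 fun v hv => ?_
    · exact mem_callTimes.2 (mem_callTimesOf.1 (hF v hv)).1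
    · exact mem_callTimes.2 (mem_callTimesOf.1 (hL v hv)).1
  set M := callTimes c m \ (S.image F ∪ S.image L) with hM
  have hMcard : M.card + (S.image F).card + (S.image L).card = (callTimes c m).card := by
    rw [add_assoc, ← Finset.card_union_of_disjoint hdisj, hM, Finset.card_sdiff_add_card_eq_card hsub]
  have hF2 := card_le_two_mul_card_image fun v hv => (mem_callTimesOf.1 (hF v hv)).2
  have hL2 := card_le_two_mul_card_image fun v hv => (mem_callTimesOf.1 (hL v hv)).2
  -- Routes from and to `x` need no first or last calls other than those of `x` itself.
  set T := insert (F x) (insert (L x) M) with hT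
  have hTcard : T.card ≤ M.card + 2 :=
    (Finset.card_insert_le _ _).trans (Nat.succ_le_succ (Finset.card_insert_le _ _))
  let G : SimpleGraph S :=
    { Adj := fun p q => p ≠ q ∧ ∃ t ∈ T, c t = s(p.1, q.1)
      symm := ⟨fun p q ⟨h, t, ht, hc⟩ => ⟨h.symm, t, ht, hc.trans Sym2.eq_swap⟩⟩
      loopless := ⟨fun p h => h.1 rfl⟩ }
  have hreach : ∀ {t p q} (hp : p ∈ S) (hq : q ∈ S), t ∈ T → c t = s(p, q) →
      G.Reachable ⟨p, hp⟩ ⟨q, hq⟩ := by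
    intro t p q hp hq ht hc
    rcases eq_or_ne p q with rfl | hpq
    · exact .refl _
    · exact SimpleGraph.Adj.reachable ⟨fun h => hpq (congrArg Subtype.val h), t, ht, hc⟩
  have hMT : ∀ {t v}, t ∈ callTimesOf c m v → t ≠ F v → t ≠ L v → t ∈ M := by
    intro t v ht h1 h2
    obtain ⟨ht, hv⟩ := mem_callTimesOf.1 ht
    rw [hM, Finset.mem_sdiff, Finset.mem_union, Finset.mem_image, Finset.mem_image]
    refine ⟨mem_callTimes.2 ht, ?_⟩
    rintro (⟨w, hw, rfl⟩ | ⟨w, hw, rfl⟩)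
    · exact h1 (hFF w hw v hv).symm
    · exact h2 (hLL w hw v hv).symm
  -- Because `p` still makes a call afterwards, no call on the route is a last call. Nor is it the
  -- first call of its informed partner `v`, unless `v = x`: nothing reaches `v` before its first
  -- call.
  have hfwd : ∀ {t p}, Flow c 0 x t p → ∀ hp : p ∈ S, (∃ q, t ≤ q ∧ q ∈ callTimesOf c m p) →
      G.Reachable ⟨x, hx⟩ ⟨p, hp⟩ := by
    intro t p h
    induction h with
    | refl => exact fun _ _ => .refl _
    | stay h ih =>
      rintro hp ⟨q, hq, hq'⟩
      exact ih hp ⟨q, by omega, hq'⟩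
    | @move t v w h hc ih =>
      rintro hw ⟨q, hq, hq'⟩
      have hv : v ∈ S := hS t v (by simp [hc])
      rcases eq_or_ne v w with rfl | hvw
      · exact ih hv ⟨q, by omega, hq'⟩
      have hqm := (mem_callTimesOf.1 hq').1.1
      have htv : t ∈ callTimesOf c m v := mem_callTimesOf.2 ⟨⟨by omega, by simpa [hc]⟩, by simp [hc]⟩
      refine (ih hv ⟨t, le_rfl, htv⟩).trans (hreach hv hw ?_ hc)
      have h2 : t ≠ L v := by
        rintro rfl
        have := hLL v hv w (by simp [hc])
        have := hLmax w hw q hq'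
        omega
      by_cases h1 : t = F v
      · have h' := h.of_no_call_end le_rfl (Nat.zero_le t) fun r _ hr hvr => by
          by_contra hd
          have := hFmin v hv r (mem_callTimesOf.2 ⟨⟨by omega, hd⟩, hvr⟩)
          omega
        obtain rfl : x = v := by
          by_contra hne
          obtain ⟨r, w, h1, h2, -⟩ := h'.exists_first_call hne
          omega
        rw [hT, h1]; simp
      · rw [hT]; simp [hMT htv h1 h2]
  have hbwd : ∀ {t p}, Flow c t p m x → ∀ hp : p ∈ S, (∃ q, q < t ∧ q ∈ callTimesOf c m p) →
      G.Reachable ⟨x, hx⟩ ⟨p, hp⟩ := by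
    intro t p h
    refine h.head_induction (P := fun t p => ∀ hp : p ∈ S, (∃ q, q < t ∧ q ∈ callTimesOf c m p) →
      G.Reachable ⟨x, hx⟩ ⟨p, hp⟩) ?_ ?_ ?_
    · exact fun _ _ => .refl _
    · rintro r p - ih hp ⟨q, hq, hq'⟩
      exact ih hp ⟨q, by omega, hq'⟩
    · rintro t w v hc h ih hw ⟨q, hq, hq'⟩
      have hv : v ∈ S := hS t v (by simp [hc])
      rcases eq_or_ne w v with rfl | hvw
      · exact ih hv ⟨q, by omega, hq'⟩
      have htm := h.le
      have htv : t ∈ callTimesOf c m v := mem_callTimesOf.2 ⟨⟨by omega, by simpa [hc]⟩, by simp [hc]⟩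
      refine (ih hv ⟨t, by omega, htv⟩).trans (hreach hw hv ?_ hc).symm
      have h1 : t ≠ F v := by
        rintro rfl
        have := hFF v hv w (by simp [hc])
        have := hFmin w hw q hq'
        omega
      by_cases h2 : t = L v
      · have h' := h.of_no_call_start htm le_rfl fun r hr hrm hvr => by
          by_contra hd
          have := hLmax v hv r (mem_callTimesOf.2 ⟨⟨hrm, hd⟩, hvr⟩)
          omega
        obtain rfl : v = x := by
          by_contra hne
          obtain ⟨r, w, h1, h2, -⟩ := h'.exists_first_call hne
          omega
        rw [hT, h2]; simp
      · rw [hT]; simp [hMT htv h1 h2]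
  have hconn : ∀ v (hv : v ∈ S), G.Reachable ⟨x, hx⟩ ⟨v, hv⟩ := by
    intro v hv
    -- A third call of `v`, neither first nor last, lies in `M`. Being useful for `x`, it has a
    -- participant on a route from or to `x`.
    obtain ⟨t, ht, h1, h2⟩ : ∃ t ∈ callTimesOf c m v, t ≠ F v ∧ t ≠ L v := by
      by_contra! h
      have hsub : callTimesOf c m v ⊆ {F v, L v} := fun t ht => by
        rw [Finset.mem_insert, Finset.mem_singleton]
        exact or_iff_not_imp_left.2 (h t ht)
      have := (Finset.card_le_card hsub).trans Finset.card_le_two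
      have := hdeg v hv
      omega
    have htT : t ∈ T := by rw [hT]; simp [hMT ht h1 h2]
    obtain ⟨ht', hvt⟩ := mem_callTimesOf.1 ht
    suffices h : ∃ p ∈ c t, ∀ hp : p ∈ S, G.Reachable ⟨x, hx⟩ ⟨p, hp⟩ by
      obtain ⟨p, hpt, hp⟩ := h
      refine (hp (hS t p hpt)).trans ?_
      rcases eq_or_ne p v with rfl | hpv
      · exact .refl _
      · exact hreach _ hv htT ((Sym2.mem_and_mem_iff hpv).1 ⟨hpt, hvt⟩)
    have htu := mem_callTimes.2 ht'
    rw [← huse, Finset.mem_union, mem_outTimes, mem_inTimes] at htu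
    rcases htu with ⟨-, p, q, hc, hp, -⟩ | ⟨-, p, q, hc, hp, -⟩
    · exact ⟨p, by simp [hc], fun hpS => hfwd hp hpS
        ⟨t, le_rfl, mem_callTimesOf.2 ⟨ht', by simp [hc]⟩⟩⟩
    · exact ⟨p, by simp [hc], fun hpS => hbwd hp hpS
        ⟨t, by omega, mem_callTimesOf.2 ⟨ht', by simp [hc]⟩⟩⟩
  -- First and last calls number at least `S.card` together, so `M` has at most `S.card - 5`
  -- elements and `T` at most `S.card - 3`, too few to connect `S`.
  have hle := card_le_of_connected_calls c T S G
    ((SimpleGraph.connected_iff_exists_forall_reachable G).2 ⟨⟨x, hx⟩, fun v => hconn v.1 v.2⟩)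
    fun p q h => h.2
  omega

/-- The gossip theorem: if everybody in `S` learns everything, there are at least `2 |S| - 4` calls
(and at least `2 |S| - 3` if `|S| ≤ 3`). -/
theorem gossip (m n : ℕ) : ∀ (c : ℕ → Sym2 V) (S : Finset V), S.card = n →
    (∀ t, ∀ v ∈ c t, v ∈ S) → (∀ u ∈ S, ∀ v ∈ S, Flow c 0 u m v) →
    2 * n ≤ (callTimes c m).card + 4 ∧ (n ≤ 3 → 2 * n ≤ (callTimes c m).card + 3) := by
  classical
  induction n with
  | zero => intros; omega
  | succ n ih =>
    intro c S hcard hS hall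
    by_cases hno : NoReturn c m
    · by_cases hM : 2 * (n + 1) ≤ (callTimes c m).card + 3
      · omega
      -- There are now at most `2 * (n + 1) - 4` calls. So everybody makes at least two, and summing
      -- this excludes `n + 1 ≤ 3`. One call fewer would give everybody at least three.
      have hdeg : ∀ x ∈ S, 2 * n ≤ (callTimes c m).card + (callTimesOf c m x).card := by
        intro x hx
        have h1 := hno.card_le hall hx
        have h2 := Finset.card_le_card (outTimes_union_inTimes_subset (c := c) (m := m) x)
        omega
      have h1 := Finset.card_nsmul_le_sum S (fun x => (callTimesOf c m x).card) 2 fun x hx => by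
        have := hdeg x hx
        omega
      rw [sum_card_callTimesOf hS, smul_eq_mul] at h1
      refine ⟨?_, by omega⟩
      by_contra hlt
      refine hlt (hcard ▸ hno.two_mul_card_le hS hall fun x hx => ?_)
      have := hdeg x hx
      omega
    · unfold NoReturn at hno
      push Not at hno
      obtain ⟨t, a, x, htm, hc, hxa, h⟩ := hno
      obtain ⟨c', h1, h2, h3⟩ := Flow.exists_contraction hS hall htm hc hxa h
      have := ih c' (S.erase a) (by rw [Finset.card_erase_of_mem (hS t a (by simp [hc]))]; omega) h1 h2
      omega

end Gossip

/-! ### From temporal graphs to calls, and the bound on the social cost -/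

section Bridge

variable {V : Type*}

/-- `Arrives E u v l`: starting from `u`, one can arrive at `v` by steps with increasing labels, the
last label being `l`; here `E x y l` says that the step from `x` to `y` with label `l` is allowed. -/
inductive Arrives (E : V → V → ℤ → Prop) (u : V) : V → ℤ → Prop
  | one {v : V} {l : ℤ} : E u v l → Arrives E u v l
  | step {v w : V} {l l' : ℤ} : Arrives E u v l → E v w l' → l < l' → Arrives E u w l'

theorem Arrives.exists_of_walk {E : V → V → ℤ → Prop} {G : TemporalGraph V}
    (hE : ∀ x y, G.graph.Adj x y → E x y (G.label s(x, y))) {u w v : V} {l : ℤ}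
    (h : Arrives E u w l) (p : G.graph.Walk w v)
    (hp : (l :: p.edges.map G.label).IsChain (· < ·)) : ∃ l', Arrives E u v l' := by
  induction p generalizing l with
  | nil => exact ⟨l, h⟩
  | cons hadj p ih =>
    rw [SimpleGraph.Walk.edges_cons, List.map_cons, List.isChain_cons_cons] at hp
    exact ih (h.step (hE _ _ hadj) hp.1) hp.2

/-- `E` may allow more steps than the graph has. For deviations it allows every label bought for an
edge, which avoids computing the least one. -/
theorem exists_arrives_of_mem_strictReach {E : V → V → ℤ → Prop} {G : TemporalGraph V}
    (hE : ∀ x y, G.graph.Adj x y → E x y (G.label s(x, y))) {u v : V} (h : v ∈ G.strictReach u)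
    (huv : v ≠ u) : ∃ l, Arrives E u v l := by
  obtain ⟨p, hp⟩ := h
  cases p with
  | nil => exact absurd rfl huv
  | cons hadj p =>
    rw [SimpleGraph.Walk.edges_cons, List.map_cons] at hp
    exact (Arrives.one (hE _ _ hadj)).exists_of_walk hE p hp

theorem positivePenalty_nonneg {K : ℝ} (hK : 0 ≤ K) (s : Profile V) (u : V) :
    0 ≤ positivePenalty K s u := by
  unfold positivePenalty; positivity

theorem properPenalty_nonneg {K : ℝ} (hK : 0 ≤ K) (s : Profile V) (u : V) :
    0 ≤ properPenalty K s u := by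
  unfold properPenalty
  split_ifs <;> simp [hK]

theorem cost_eq (K : ℝ) (s : Profile V) (u : V) :
    cost K s u = (s u).1.card + positivePenalty K s u + properPenalty K s u
      + K * (((temporalGraph s).strictReach u)ᶜ.ncard : ℝ) := by
  simp [cost, labelCost]

theorem le_cost {K : ℝ} (hK : 1 ≤ K) (s : Profile V) (u : V) :
    ((s u).1.card : ℝ) + (((temporalGraph s).strictReach u)ᶜ.ncard : ℝ) ≤ cost K s u := by
  rw [cost_eq]
  have h1 := positivePenalty_nonneg (zero_le_one.trans hK) s u
  have h2 := properPenalty_nonneg (zero_le_one.trans hK) s u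
  have h3 := mul_le_mul_of_nonneg_right hK
    (Nat.cast_nonneg (α := ℝ) (((temporalGraph s).strictReach u)ᶜ.ncard))
  linarith

variable [Fintype V]

/-- In a temporal graph, the number of edges plus the number of pairs `(u, v)` such that `u` does
not reach `v` is at least `2 n - 4`. -/
theorem TemporalGraph.two_mul_card_le (G : TemporalGraph V) :
    2 * Fintype.card V ≤ G.graph.edgeSet.ncard + ∑ u, (G.strictReach u)ᶜ.ncard + 4 ∧
    (Fintype.card V ≤ 3 →
      2 * Fintype.card V ≤ G.graph.edgeSet.ncard + ∑ u, (G.strictReach u)ᶜ.ncard + 3) := by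
  classical
  rcases isEmpty_or_nonempty V with hV | ⟨⟨x₀⟩⟩
  · simp
  -- Ties between equal labels may be broken arbitrarily: labels on a strict path increase strictly,
  -- hence so do the positions in the sorted list.
  set L₁ : List (Sym2 V) := G.graph.edgeSet.toFinite.toFinset.toList.mergeSort
    (fun e e' => decide (G.label e ≤ G.label e')) with hL₁
  have hmem : ∀ e, e ∈ L₁ ↔ e ∈ G.graph.edgeSet := by simp [hL₁]
  have hlen₁ : L₁.length = G.graph.edgeSet.ncard := by
    rw [hL₁, List.length_mergeSort, Finset.length_toList, Set.ncard_eq_toFinset_card]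
  have hsorted : L₁.Pairwise fun e e' => G.label e ≤ G.label e' := by
    have := List.pairwise_mergeSort (le := fun e e' => decide (G.label e ≤ G.label e'))
      (by simp only [decide_eq_true_eq]; intro a b c; exact le_trans)
      (by simp only [Bool.or_eq_true, decide_eq_true_eq]; intro a b; exact le_total _ _)
      G.graph.edgeSet.toFinite.toFinset.toList
    simpa only [decide_eq_true_eq] using this
  set U : Finset (V × V) := Finset.univ.filter fun p => p.2 ∉ G.strictReach p.1 with hU
  have hUcard : U.card = ∑ u, (G.strictReach u)ᶜ.ncard := by
    rw [hU, Finset.card_filter, Fintype.sum_prod_type]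
    refine Finset.sum_congr rfl fun u _ => ?_
    rw [← Finset.card_filter, Set.ncard_eq_toFinset_card']
    congr 1
    ext v
    simp
  -- Each unreached pair is repaired by one direct call after all edges.
  set L : List (Sym2 V) := L₁ ++ U.toList.map fun p => s(p.1, p.2) with hL
  have hlen : L.length = G.graph.edgeSet.ncard + ∑ u, (G.strictReach u)ᶜ.ncard := by
    rw [hL, List.length_append, List.length_map, Finset.length_toList, hlen₁, hUcard]
  -- The diagonal default means that nobody calls after the end of the list.
  set c : ℕ → Sym2 V := fun t => (L[t]?).getD s(x₀, x₀) with hc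
  have hc₁ : ∀ t (ht : t < L₁.length), c t = L₁[t] := by
    intro t ht
    simp [hc, hL, List.getElem?_append_left ht, List.getElem?_eq_getElem ht]
  have harr : ∀ {u v l}, Arrives (fun x y l => G.graph.Adj x y ∧ G.label s(x, y) = l) u v l →
      ∃ t, ∃ ht : t < L₁.length, G.label L₁[t] = l ∧ Flow c 0 u (t + 1) v := by
    intro u v l h
    induction h with
    | @one v l h =>
      obtain ⟨t, ht, he⟩ := List.mem_iff_getElem.1 ((hmem s(u, v)).2 h.1)
      exact ⟨t, ht, by rw [he, h.2], (Flow.single ((hc₁ t ht).trans he)).mono (Nat.zero_le t) le_rfl⟩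
    | @step v w l l' _ h hlt ih =>
      obtain ⟨t, ht, hl, hf⟩ := ih
      obtain ⟨t', ht', he⟩ := List.mem_iff_getElem.1 ((hmem s(v, w)).2 h.1)
      refine ⟨t', ht', by rw [he, h.2], hf.trans ((Flow.single ((hc₁ t' ht').trans he)).mono ?_ le_rfl)⟩
      by_contra! hlt'
      have : G.label L₁[t'] ≤ G.label L₁[t] := by
        rcases (Nat.lt_succ_iff.1 hlt').eq_or_lt with h' | h'
        · simp [h']
        · exact List.pairwise_iff_getElem.1 hsorted _ _ _ _ h'
      rw [hl, he, h.2] at this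
      omega
  have hall : ∀ u ∈ Finset.univ, ∀ v ∈ Finset.univ, Flow c 0 u L.length v := by
    intro u _ v _
    rcases eq_or_ne v u with rfl | huv
    · exact Flow.idle v (Nat.zero_le _)
    by_cases h : v ∈ G.strictReach u
    · obtain ⟨l, hl⟩ := exists_arrives_of_mem_strictReach
        (E := fun x y l => G.graph.Adj x y ∧ G.label s(x, y) = l) (fun x y h => ⟨h, rfl⟩) h huv
      obtain ⟨t, ht, -, hf⟩ := harr hl
      refine hf.mono le_rfl ?_
      rw [hL, List.length_append]
      omega
    · have hmem : s(u, v) ∈ L := by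
        rw [hL, List.mem_append]
        have huv : (u, v) ∈ U := by simp [hU, h]
        exact Or.inr (List.mem_map_of_mem (f := fun p : V × V => s(p.1, p.2))
          (Finset.mem_toList.2 huv))
      obtain ⟨t, ht, he⟩ := List.mem_iff_getElem.1 hmem
      refine (Flow.single (c := c) (t := t) ?_).mono (Nat.zero_le t) ht
      simp [hc, List.getElem?_eq_getElem ht, he]
  have h := gossip L.length (Fintype.card V) c Finset.univ Finset.card_univ (by simp) hall
  have hcalls : (callTimes c L.length).card ≤ L.length :=
    (Finset.card_filter_le _ _).trans (Finset.card_range _).le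
  omega

theorem ncard_edgeSet_le (s : Profile V) :
    (temporalGraph s).graph.edgeSet.ncard ≤ ∑ u, (s u).1.card := by
  classical
  let T : Finset (Sym2 V) := Finset.univ.biUnion fun u => (s u).1.image fun p => s(u, p.1)
  have hsub : (temporalGraph s).graph.edgeSet ⊆ (T : Set (Sym2 V)) := by
    intro e he
    induction e with
    | _ u v =>
      simp only [T, Finset.coe_biUnion, Set.mem_iUnion, Finset.mem_coe, Finset.mem_image]
      obtain ⟨l, h | h⟩ := he
      · exact ⟨u, Finset.mem_univ u, (v, l), h, rfl⟩
      · exact ⟨v, Finset.mem_univ v, (u, l), h, Sym2.eq_swap⟩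
  calc _ ≤ (T : Set (Sym2 V)).ncard := Set.ncard_le_ncard hsub T.finite_toSet
    _ = T.card := Set.ncard_coe_finset T
    _ ≤ _ := Finset.card_biUnion_le.trans (Finset.sum_le_sum fun u _ => Finset.card_image_le)

/-- As `K ≥ 1`, an unreached agent costs at least as much as the call that would repair the pair. -/
theorem two_mul_card_le_socialCost {K : ℝ} (hK : 1 ≤ K) (s : Profile V) :
    2 * (Fintype.card V : ℝ) - 4 ≤ socialCost K s ∧
    (Fintype.card V ≤ 3 → 2 * (Fintype.card V : ℝ) - 3 ≤ socialCost K s) := by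
  have h1 : ((∑ u, (s u).1.card + ∑ u, ((temporalGraph s).strictReach u)ᶜ.ncard : ℕ) : ℝ) ≤
      socialCost K s := by
    push_cast
    rw [← Finset.sum_add_distrib]
    exact Finset.sum_le_sum fun u _ => le_cost hK s u
  have h2 := (temporalGraph s).two_mul_card_le
  have h3 := ncard_edgeSet_le s
  refine ⟨?_, fun h => ?_⟩
  · have : 2 * Fintype.card V ≤
        (∑ u, (s u).1.card + ∑ u, ((temporalGraph s).strictReach u)ᶜ.ncard) + 4 := by omega
    have : (2 * Fintype.card V : ℝ) ≤
        (∑ u, (s u).1.card + ∑ u, ((temporalGraph s).strictReach u)ᶜ.ncard : ℕ) + 4 := by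
      exact_mod_cast this
    linarith
  · have : 2 * Fintype.card V ≤
        (∑ u, (s u).1.card + ∑ u, ((temporalGraph s).strictReach u)ᶜ.ncard) + 3 := by omega
    have : (2 * Fintype.card V : ℝ) ≤
        (∑ u, (s u).1.card + ∑ u, ((temporalGraph s).strictReach u)ᶜ.ncard : ℕ) + 3 := by
      exact_mod_cast this
    linarith

end Bridge

/-! ### Reachability by steps with increasing labels -/

section Reachability

variable {V : Type*}

/-- The steps of a temporal graph. -/
def TemporalGraph.Step (G : TemporalGraph V) (x y : V) (l : ℤ) : Prop :=
  G.graph.Adj x y ∧ G.label s(x, y) = l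

theorem Arrives.mem_strictReach {G : TemporalGraph V} {u v : V} {l : ℤ}
    (h : Arrives G.Step u v l) :
    v ∈ G.strictReach u := by
  -- The induction must remember the last label of the walk in order to append a step.
  suffices h : ∃ p : G.graph.Walk u v, (p.edges.map G.label).IsChain (· < ·) ∧
      ∀ l' ∈ (p.edges.map G.label).getLast?, l' = l by
    obtain ⟨p, hp, -⟩ := h
    exact ⟨p, hp⟩
  induction h with
  | one h => exact ⟨.cons h.1 .nil, by simp, by simp [h.2]⟩
  | step _ h hlt ih =>
    obtain ⟨p, hp, hlast⟩ := ih
    refine ⟨p.concat h.1, ?_, ?_⟩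
    · rw [SimpleGraph.Walk.edges_concat, List.concat_eq_append, List.map_append,
        List.isChain_append]
      refine ⟨hp, by simp, fun x hx y hy => ?_⟩
      obtain rfl : G.label s(_, _) = y := by simpa using hy
      rw [hlast x hx, h.2]
      exact hlt
    · simp [SimpleGraph.Walk.edges_concat, List.concat_eq_append, h.2]

/-- Starting from `u`, one can be at `w` by steps with increasing labels smaller than `t`. -/
def AtBefore (E : V → V → ℤ → Prop) (u w : V) (t : ℤ) : Prop := w = u ∨ ∃ l < t, Arrives E u w l

theorem AtBefore.refl (E : V → V → ℤ → Prop) (u : V) (t : ℤ) : AtBefore E u u t := Or.inl rfl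

theorem AtBefore.move {E : V → V → ℤ → Prop} {u w x : V} {t l : ℤ} (h : AtBefore E u w t)
    (hE : E w x l) (hl : t ≤ l) : AtBefore E u x (l + 1) := by
  refine Or.inr ⟨l, by omega, ?_⟩
  rcases h with rfl | ⟨l', hl', h⟩
  · exact .one hE
  · exact h.step hE (by omega)

theorem AtBefore.mono {E : V → V → ℤ → Prop} {u w : V} {t t' : ℤ} (h : AtBefore E u w t)
    (ht : t ≤ t') : AtBefore E u w t' :=
  h.imp id fun ⟨l, hl, h⟩ => ⟨l, by omega, h⟩

theorem AtBefore.mem_strictReach {G : TemporalGraph V} {u v : V} {t : ℤ}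
    (h : AtBefore G.Step u v t) :
    v ∈ G.strictReach u := by
  rcases h with rfl | ⟨l, -, h⟩
  · exact ⟨.nil, by simp⟩
  · exact h.mem_strictReach

theorem Arrives.cases_last {E : V → V → ℤ → Prop} {u v : V} {l : ℤ} (h : Arrives E u v l) :
    ∃ x, E x v l ∧ (x = u ∨ ∃ l' < l, Arrives E u x l') := by
  rcases h with h | ⟨h, hE, hlt⟩
  · exact ⟨u, h, Or.inl rfl⟩
  · exact ⟨_, hE, Or.inr ⟨_, hlt, h⟩⟩

/-- If all steps from `u` have labels at least `b`, no step with a smaller label is taken. -/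
theorem Arrives.le_of_start {E : V → V → ℤ → Prop} {u v : V} {l b : ℤ} (h : Arrives E u v l)
    (hb : ∀ v l, E u v l → b ≤ l) : b ≤ l := by
  induction h with
  | one h => exact hb _ _ h
  | step _ _ hlt ih => omega

end Reachability

/-! ### Penalty-free costs and unilateral deviations -/

section Deviation

variable {V : Type*}

theorem cost_eq_card (K : ℝ) {s : Profile V} {u : V} (hpos : ∀ v l, Buys s u v l → 1 ≤ l)
    (hown : ∀ v w l, Buys s u v l → Buys s u w l → v = w)
    (hother : ∀ v l x w, Buys s u v l → x ≠ u → Buys s x w l → ¬ (x = v ∨ w = v ∨ w = u))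
    (hreach : (temporalGraph s).strictReach u = Set.univ) : cost K s u = (s u).1.card := by
  have h1 : (s u).1.filter (fun p => p.2 < 1) = ∅ :=
    Finset.filter_eq_empty_iff.2 fun p hp => not_lt.2 (hpos p.1 p.2 hp)
  have h2 : ¬ ∃ v w l, v ≠ w ∧ Buys s u v l ∧ Buys s u w l :=
    fun ⟨v, w, l, hne, hv, hw⟩ => hne (hown v w l hv hw)
  have h3 : ¬ ∃ v l, Buys s u v l ∧ ∃ x w, x ≠ u ∧ Buys s x w l ∧ (x = v ∨ w = v ∨ w = u) :=
    fun ⟨v, l, hb, x, w, hx, hb', h⟩ => hother v l x w hb hx hb' h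
  rw [cost_eq, positivePenalty, properPenalty, h1, if_neg h2, if_neg h3, hreach]
  simp

variable [Finite V]

theorem label_eq_of_buys {s : Profile V} {x y : V} {l : ℤ}
    (huniq : ∀ l', Buys s x y l' ∨ Buys s y x l' → l' = l) (h : Buys s x y l ∨ Buys s y x l) :
    (temporalGraph s).Step x y l := by
  have hadj : (temporalGraph s).graph.Adj x y := ⟨l, h⟩
  refine ⟨hadj, ?_⟩
  obtain ⟨u, v, he, hb⟩ := (isLeast_label s (e := s(x, y)) hadj).1
  rw [Sym2.eq_iff] at he
  rcases he with ⟨rfl, rfl⟩ | ⟨rfl, rfl⟩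
  · exact huniq _ (Or.inl hb)
  · exact huniq _ (Or.inr hb)

theorem buys_label {s : Profile V} {x y : V} (h : (temporalGraph s).graph.Adj x y) :
    Buys s x y ((temporalGraph s).label s(x, y)) ∨ Buys s y x ((temporalGraph s).label s(x, y)) := by
  obtain ⟨u, v, he, hb⟩ := (isLeast_label s (e := s(x, y)) h).1
  rw [Sym2.eq_iff] at he
  rcases he with ⟨rfl, rfl⟩ | ⟨rfl, rfl⟩
  · exact Or.inl hb
  · exact Or.inr hb

/-- Any single penalty, and any single unreached agent, already costs `K`. -/
theorem of_cost_lt {K : ℝ} (hK : 0 ≤ K) {s : Profile V} {u : V} (h : cost K s u < K) :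
    ((s u).1.card : ℝ) ≤ cost K s u ∧ (∀ v l, Buys s u v l → 1 ≤ l) ∧
    (∀ v l x w, Buys s u v l → x ≠ u → Buys s x w l → ¬ (x = v ∨ w = v ∨ w = u)) ∧
    ∀ v, v ∈ (temporalGraph s).strictReach u := by
  have h1 := positivePenalty_nonneg hK s u
  have h2 := properPenalty_nonneg hK s u
  have h3 : 0 ≤ K * (((temporalGraph s).strictReach u)ᶜ.ncard : ℝ) := by positivity
  have h4 : (0 : ℝ) ≤ (s u).1.card := Nat.cast_nonneg _
  have hmul : ∀ k : ℕ, k ≠ 0 → K ≤ K * k := fun k hk =>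
    le_mul_of_one_le_right hK (by exact_mod_cast Nat.one_le_iff_ne_zero.2 hk)
  rw [cost_eq] at h ⊢
  refine ⟨by linarith, fun v l hb => ?_, fun v l x w hb hx hb' hinc => ?_, fun v => ?_⟩
  · by_contra! hl
    have : K ≤ positivePenalty K s u := hmul _
      (Finset.card_ne_zero_of_mem (Finset.mem_filter.2 ⟨(hb : (v, l) ∈ (s u).1), hl⟩))
    linarith
  · have : K ≤ properPenalty K s u := by
      unfold properPenalty
      rw [if_pos (c := ∃ v l, Buys s u v l ∧ ∃ x w, x ≠ u ∧ Buys s x w l ∧ (x = v ∨ w = v ∨ w = u))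
        ⟨v, l, hb, x, w, hx, hb', hinc⟩]
      split_ifs <;> simp [hK]
    linarith
  · by_contra hv
    have := hmul _ (((Set.ncard_pos (Set.toFinite _)).2 ⟨v, hv⟩).ne' :
      ((temporalGraph s).strictReach u)ᶜ.ncard ≠ 0)
    linarith

/-- The steps, with any of the labels bought for them, when `u` deviates from `s` to `S'`. -/
def DevStep (s : Profile V) (u : V) (S' : Strategy u) (x y : V) (l : ℤ) : Prop :=
  (x = u ∧ (y, l) ∈ S'.1) ∨ (x ≠ u ∧ Buys s x y l) ∨ (y = u ∧ (x, l) ∈ S'.1) ∨ (y ≠ u ∧ Buys s y x l)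

/-- A profile without penalties is an equilibrium if every deviation to fewer edges without
penalties leaves somebody unreached. -/
theorem isNash_of_forall [DecidableEq V] {K : ℝ} {s : Profile V}
    (hcost : ∀ u, cost K s u = (s u).1.card) (hK : ∀ u, ((s u).1.card : ℝ) ≤ K)
    (hdev : ∀ (u : V) (S' : Strategy u), S'.1.card < (s u).1.card →
      (∀ v l, (v, l) ∈ S'.1 → 1 ≤ l) →
      (∀ v l x w, (v, l) ∈ S'.1 → x ≠ u → Buys s x w l → ¬ (x = v ∨ w = v ∨ w = u)) →
      ¬ ∀ v, v ≠ u → ∃ l, Arrives (DevStep s u S') u v l) : IsNash K s := by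
  intro u S' hlt
  rw [hcost u] at hlt
  have hself : ∀ v l, Buys (Function.update s u S') u v l ↔ (v, l) ∈ S'.1 := by
    intro v l
    rw [Buys, Function.update_self]
  have hne : ∀ x v l, x ≠ u → (Buys (Function.update s u S') x v l ↔ Buys s x v l) := by
    intro x v l hx
    rw [Buys, Function.update_of_ne hx, Buys]
  -- The deviation is cheaper than the present cost, which is at most `K`.
  obtain ⟨h1, h2, h3, h4⟩ := of_cost_lt ((Nat.cast_nonneg _).trans (hK u)) (hlt.trans_le (hK u))
  rw [Function.update_self] at h1
  have hcard : S'.1.card < (s u).1.card := by exact_mod_cast h1.trans_lt hlt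
  refine hdev u S' hcard (fun v l h => h2 v l ((hself v l).2 h))
    (fun v l x w h hx hb => h3 v l x w ((hself v l).2 h) hx ((hne x w l hx).2 hb)) fun v hv => ?_
  refine exists_arrives_of_mem_strictReach (fun x y hadj => ?_) (h4 v) hv
  have key : ∀ x y l, Buys (Function.update s u S') x y l →
      (x = u ∧ (y, l) ∈ S'.1) ∨ (x ≠ u ∧ Buys s x y l) := by
    intro x y l h
    by_cases hx : x = u
    · subst hx
      exact Or.inl ⟨rfl, (hself _ _).1 h⟩
    · exact Or.inr ⟨hx, (hne _ _ _ hx).1 h⟩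
  rcases buys_label hadj with h | h
  · rcases key _ _ _ h with h | h
    · exact Or.inl h
    · exact Or.inr (Or.inl h)
  · rcases key _ _ _ h with h | h
    · exact Or.inr (Or.inr (Or.inl h))
    · exact Or.inr (Or.inr (Or.inr h))

end Deviation

/-! ### The ring profile: proper labeling, connectivity and number of edges -/

section Ring

/-- The purchases of the ring profile, as linear conditions. -/
def RingRel (n i j : ℕ) (l : ℤ) : Prop :=
  (i = 0 ∧ j = 1 ∧ l = n) ∨ (i = 1 ∧ j = 2 ∧ l = n + 1) ∨
  (i = 2 ∧ j = 3 ∧ l = n) ∨ (i = 3 ∧ j = 0 ∧ l = n + 1) ∨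
  (4 ≤ i ∧ j = 0 ∧ i % 2 = 0 ∧ 2 * l = i - 2) ∨
  (i = 2 ∧ 4 ≤ j ∧ j % 2 = 0 ∧ 2 * l = 2 * n + j) ∨
  (4 ≤ i ∧ j = 2 ∧ i % 2 = 1 ∧ 2 * l = i - 3) ∨
  (i = 0 ∧ 4 ≤ j ∧ j % 2 = 1 ∧ 2 * l = 2 * n + j - 1)

theorem ringLabel_eq_some {n i j : ℕ} {l : ℤ} : ringLabel n i j = some l ↔ RingRel n i j l := by
  unfold RingRel
  rcases i with _ | _ | _ | _ | i <;> rcases j with _ | _ | _ | _ | j <;>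
    simp [ringLabel, Nat.even_iff, Nat.odd_iff] <;> omega

namespace RingRel

variable {n i j : ℕ} {l : ℤ}

theorem zero_one (hi : i = 0) (hj : j = 1) : RingRel n i j n := Or.inl ⟨hi, hj, rfl⟩

theorem one_two (hi : i = 1) (hj : j = 2) : RingRel n i j (n + 1) := Or.inr (Or.inl ⟨hi, hj, rfl⟩)

theorem two_three (hi : i = 2) (hj : j = 3) : RingRel n i j n :=
  Or.inr (Or.inr (Or.inl ⟨hi, hj, rfl⟩))

theorem three_zero (hi : i = 3) (hj : j = 0) : RingRel n i j (n + 1) :=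
  Or.inr (Or.inr (Or.inr (Or.inl ⟨hi, hj, rfl⟩)))

theorem even_zero (hi : 4 ≤ i) (hi' : i % 2 = 0) (hj : j = 0) (hl : 2 * l = i - 2) :
    RingRel n i j l :=
  Or.inr (Or.inr (Or.inr (Or.inr (Or.inl ⟨hi, hj, hi', hl⟩))))

theorem two_even (hi : i = 2) (hj : 4 ≤ j) (hj' : j % 2 = 0) (hl : 2 * l = 2 * n + j) :
    RingRel n i j l :=
  Or.inr (Or.inr (Or.inr (Or.inr (Or.inr (Or.inl ⟨hi, hj, hj', hl⟩)))))

theorem odd_two (hi : 4 ≤ i) (hi' : i % 2 = 1) (hj : j = 2) (hl : 2 * l = i - 3) :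
    RingRel n i j l :=
  Or.inr (Or.inr (Or.inr (Or.inr (Or.inr (Or.inr (Or.inl ⟨hi, hj, hi', hl⟩))))))

theorem zero_odd (hi : i = 0) (hj : 4 ≤ j) (hj' : j % 2 = 1) (hl : 2 * l = 2 * n + j - 1) :
    RingRel n i j l :=
  Or.inr (Or.inr (Or.inr (Or.inr (Or.inr (Or.inr (Or.inr ⟨hi, hj, hj', hl⟩))))))

end RingRel

/-- The bounds by `n` keep the early labels below `n`, hence apart from the ring labels `n` and `n +
1` and the late labels from `n + 2` on; within one phase, the label and the hub determine the outer
agent. -/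
theorem ringRel_unique {n i j k : ℕ} {l : ℤ} (hi : i < n) (hj : j < n) (hk : k < n)
    (h : RingRel n i j l ∨ RingRel n j i l) (h' : RingRel n i k l ∨ RingRel n k i l) : j = k := by
  unfold RingRel at h h'
  rcases h with h | h <;> rcases h with h | h | h | h | h | h | h | h <;> omega

variable {V : Type*} [Fintype V] {num : V ≃ Fin (Fintype.card V)}

theorem eq_of_num {u v : V} (h : (num u : ℕ) = num v) : u = v := num.injective (Fin.ext h)

variable [DecidableEq V]

theorem buys_ring {u v : V} {l : ℤ} :
    Buys (ringProfile num) u v l ↔ RingRel (Fintype.card V) (num u) (num v) l := by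
  rw [buys_ringProfile, ringLabel_eq_some]

theorem ring_step {x y : V} {l : ℤ} (h : RingRel (Fintype.card V) (num x) (num y) l ∨
      RingRel (Fintype.card V) (num y) (num x) l) :
    (temporalGraph (ringProfile num)).Step x y l := by
  refine label_eq_of_buys (fun l' h' => ?_) (by rwa [buys_ring, buys_ring])
  rw [buys_ring, buys_ring] at h'
  unfold RingRel at h h'
  omega

theorem ring_isProper (num : V ≃ Fin (Fintype.card V)) :
    (temporalGraph (ringProfile num)).IsProper := by
  intro e he e' he' hne ⟨v, hv, hv'⟩ heq
  obtain ⟨x, rfl⟩ := hv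
  obtain ⟨y, rfl⟩ := hv'
  have hxy : (num x : ℕ) ≠ num y := fun h => hne (by rw [eq_of_num h])
  have h1 := buys_label he
  have h2 := buys_label he'
  rw [← heq, buys_ring, buys_ring] at h2
  rw [buys_ring, buys_ring] at h1
  exact hxy (ringRel_unique (num v).2 (num x).2 (num y).2 h1 h2)

/-- From agent `0` the information goes to `1` at time `n`, and to `2` and `3` at time `n + 1`. Then
both hubs are informed, and each outer agent hears from one of them. -/
theorem ring_atBefore_of_hub_zero {u a v : V} (hn : 4 ≤ Fintype.card V) (ha : (num a : ℕ) = 0)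
    (h : AtBefore (temporalGraph (ringProfile num)).Step u a (Fintype.card V)) :
    ∃ t, AtBefore (temporalGraph (ringProfile num)).Step u v t := by
  obtain ⟨b, hb⟩ : ∃ b, (num b : ℕ) = 1 := ⟨num.symm ⟨1, by omega⟩, by simp⟩
  obtain ⟨c, hc⟩ : ∃ c, (num c : ℕ) = 2 := ⟨num.symm ⟨2, by omega⟩, by simp⟩
  have hab := h.move (ring_step  (x := a) (y := b) (.inl (.zero_one ha hb)))
    le_rfl
  have hbc := hab.move (ring_step (x := b) (y := c) (.inl (.one_two hb hc))) le_rfl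
  have hv := (num v).2
  by_cases h0 : (num v : ℕ) = 0
  · obtain rfl : v = a := eq_of_num (num := num) (by omega)
    exact ⟨_, h⟩
  by_cases h1 : (num v : ℕ) = 1
  · obtain rfl : v = b := eq_of_num (num := num) (by omega)
    exact ⟨_, hab⟩
  by_cases h2 : (num v : ℕ) = 2
  · obtain rfl : v = c := eq_of_num (num := num) (by omega)
    exact ⟨_, hbc⟩
  by_cases h3 : (num v : ℕ) = 3
  · exact ⟨_, h.move (ring_step (.inr (.three_zero h3 ha))) (by omega)⟩
  by_cases h4 : (num v : ℕ) % 2 = 0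
  · exact ⟨_, hbc.move (ring_step (l := Fintype.card V + (num v : ℕ) / 2)
      (.inl (.two_even hc (by omega) h4 (by omega)))) (by omega)⟩
  · exact ⟨_, h.move (ring_step (l := Fintype.card V + ((num v : ℕ) - 1) / 2)
      (.inl (.zero_odd ha (by omega) (by omega) (by omega)))) (by omega)⟩

theorem ring_atBefore_of_hub_two {u c v : V} (hn : 4 ≤ Fintype.card V) (hc : (num c : ℕ) = 2)
    (h : AtBefore (temporalGraph (ringProfile num)).Step u c (Fintype.card V)) :
    ∃ t, AtBefore (temporalGraph (ringProfile num)).Step u v t := by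
  obtain ⟨d, hd⟩ : ∃ d, (num d : ℕ) = 3 := ⟨num.symm ⟨3, by omega⟩, by simp⟩
  obtain ⟨a, ha⟩ : ∃ a, (num a : ℕ) = 0 := ⟨num.symm ⟨0, by omega⟩, by simp⟩
  have hcd := h.move (ring_step (x := c) (y := d) (.inl (.two_three hc hd)))
    le_rfl
  have hda := hcd.move (ring_step (x := d) (y := a) (.inl (.three_zero hd ha))) le_rfl
  have hv := (num v).2
  by_cases h2 : (num v : ℕ) = 2
  · obtain rfl : v = c := eq_of_num (num := num) (by omega)
    exact ⟨_, h⟩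
  by_cases h3 : (num v : ℕ) = 3
  · obtain rfl : v = d := eq_of_num (num := num) (by omega)
    exact ⟨_, hcd⟩
  by_cases h0 : (num v : ℕ) = 0
  · obtain rfl : v = a := eq_of_num (num := num) (by omega)
    exact ⟨_, hda⟩
  by_cases h1 : (num v : ℕ) = 1
  · exact ⟨_, h.move (ring_step (.inr (.one_two h1 hc))) (by omega)⟩
  by_cases h4 : (num v : ℕ) % 2 = 0
  · exact ⟨_, h.move (ring_step (l := Fintype.card V + (num v : ℕ) / 2)
      (.inl (.two_even hc (by omega) h4 (by omega)))) (by omega)⟩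
  · exact ⟨_, hda.move (ring_step (l := Fintype.card V + ((num v : ℕ) - 1) / 2)
      (.inl (.zero_odd ha (by omega) (by omega) (by omega)))) (by omega)⟩

/-- An agent who can be at both hubs at time `n + 1`, and at one of them before, reaches all. -/
theorem ring_atBefore_of_hubs {u a c v : V} (ha : (num a : ℕ) = 0)
    (hc : (num c : ℕ) = 2)
    (hua : AtBefore (temporalGraph (ringProfile num)).Step u a (Fintype.card V + 2))
    (huc : AtBefore (temporalGraph (ringProfile num)).Step u c (Fintype.card V + 2))
    (h1 : (num v : ℕ) = 1 → ∃ t, AtBefore (temporalGraph (ringProfile num)).Step u v t)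
    (h3 : (num v : ℕ) = 3 → ∃ t, AtBefore (temporalGraph (ringProfile num)).Step u v t) :
    ∃ t, AtBefore (temporalGraph (ringProfile num)).Step u v t := by
  by_cases h0 : (num v : ℕ) = 0
  · obtain rfl : v = a := eq_of_num (num := num) (by omega)
    exact ⟨_, hua⟩
  by_cases h2 : (num v : ℕ) = 2
  · obtain rfl : v = c := eq_of_num (num := num) (by omega)
    exact ⟨_, huc⟩
  by_cases h1' : (num v : ℕ) = 1
  · exact h1 h1'
  by_cases h3' : (num v : ℕ) = 3
  · exact h3 h3'
  by_cases h4 : (num v : ℕ) % 2 = 0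
  · exact ⟨_, huc.move (ring_step (l := Fintype.card V + (num v : ℕ) / 2)
      (.inl (.two_even hc (by omega) h4 (by omega)))) (by omega)⟩
  · exact ⟨_, hua.move (ring_step (l := Fintype.card V + ((num v : ℕ) - 1) / 2)
      (.inl (.zero_odd ha (by omega) (by omega) (by omega)))) (by omega)⟩

theorem ring_isTemporallyConnected (hn : 4 ≤ Fintype.card V) (num : V ≃ Fin (Fintype.card V)) :
    (temporalGraph (ringProfile num)).IsTemporallyConnected := by
  intro u
  rw [Set.eq_univ_iff_forall]
  intro v
  suffices h : ∃ t, AtBefore (temporalGraph (ringProfile num)).Step u v t by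
    obtain ⟨t, ht⟩ := h
    exact ht.mem_strictReach
  obtain ⟨a, ha⟩ : ∃ a, (num a : ℕ) = 0 := ⟨num.symm ⟨0, by omega⟩, by simp⟩
  obtain ⟨c, hc⟩ : ∃ c, (num c : ℕ) = 2 := ⟨num.symm ⟨2, by omega⟩, by simp⟩
  have hu := (num u).2
  have h := fun t => AtBefore.refl (temporalGraph (ringProfile num)).Step u t
  by_cases h0 : (num u : ℕ) = 0
  · exact ring_atBefore_of_hub_zero hn h0 (h _)
  by_cases h2 : (num u : ℕ) = 2
  · exact ring_atBefore_of_hub_two hn h2 (h _)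
  by_cases h1 : (num u : ℕ) = 1
  · have hua := (h _).move (ring_step (x := u) (y := a) (.inr (.zero_one ha h1))) le_rfl
    have huc := (h _).move (ring_step (x := u) (y := c) (.inl (.one_two h1 hc))) le_rfl
    refine ring_atBefore_of_hubs ha hc (hua.mono (by omega)) (huc.mono (by omega)) (fun hv => ?_)
      fun hv => ?_
    · obtain rfl : v = u := eq_of_num (num := num) (by omega)
      exact ⟨_, h 0⟩
    · exact ⟨_, hua.move (ring_step (.inr (.three_zero hv ha))) le_rfl⟩
  by_cases h3 : (num u : ℕ) = 3
  · have huc := (h _).move (ring_step (x := u) (y := c) (.inr (.two_three hc h3))) le_rfl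
    have hua := (h _).move (ring_step (x := u) (y := a) (.inl (.three_zero h3 ha))) le_rfl
    refine ring_atBefore_of_hubs ha hc (hua.mono (by omega)) (huc.mono (by omega)) (fun hv => ?_)
      fun hv => ?_
    · exact ⟨_, huc.move (ring_step (.inr (.one_two hv hc))) le_rfl⟩
    · obtain rfl : v = u := eq_of_num (num := num) (by omega)
      exact ⟨_, h 0⟩
  by_cases h4 : (num u : ℕ) % 2 = 0
  · exact ring_atBefore_of_hub_zero hn ha (((h _).move (ring_step (l := (((num u : ℕ) - 2) / 2 : ℤ))
      (.inl (.even_zero (by omega) h4 ha (by omega)))) le_rfl).mono (by omega))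
  · exact ring_atBefore_of_hub_two hn hc (((h _).move (ring_step (l := (((num u : ℕ) - 3) / 2 : ℤ))
      (.inl (.odd_two (by omega) (by omega) hc (by omega)))) le_rfl).mono (by omega))

/-- By `ringRel_unique`, equal labels at a common agent belong to the same edge, and each edge is
bought from one side only. -/
theorem ring_hother {u v x w : V} {l : ℤ} (hb : Buys (ringProfile num) u v l) (hx : x ≠ u)
    (hb' : Buys (ringProfile num) x w l) : ¬ (x = v ∨ w = v ∨ w = u) := by
  rw [buys_ring] at hb hb'
  have hu := (num u).2
  have hv := (num v).2
  have hx' := (num x).2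
  have hw := (num w).2
  rintro (rfl | rfl | rfl)
  · have := ringRel_unique hx' hu hw (Or.inr hb) (Or.inl hb')
    rw [this] at hb
    unfold RingRel at hb hb'
    omega
  · exact hx (eq_of_num (ringRel_unique hv hx' hu (Or.inr hb') (Or.inr hb)))
  · have := ringRel_unique hu hv hx' (Or.inl hb) (Or.inr hb')
    rw [this] at hb
    unfold RingRel at hb hb'
    omega

theorem ring_cost (K : ℝ) (hn : 4 ≤ Fintype.card V) (num : V ≃ Fin (Fintype.card V)) (u : V) :
    cost K (ringProfile num) u = (ringProfile num u).1.card := by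
  refine cost_eq_card K (fun v l h => ?_) (fun v w l h h' => ?_)
    (fun v l x w => ring_hother) (ring_isTemporallyConnected hn num u)
  · rw [buys_ring] at h
    unfold RingRel at h
    omega
  · rw [buys_ring] at h h'
    exact eq_of_num (ringRel_unique (num u).2 (num v).2 (num w).2 (Or.inl h) (Or.inl h'))

/-- Only this upper bound needs counting; the gossip bound supplies the reverse inequality. -/
theorem ring_sum_card (hn : 4 ≤ Fintype.card V) (num : V ≃ Fin (Fintype.card V)) :
    ∑ u, (ringProfile num u).1.card + 4 ≤ 2 * Fintype.card V := by
  rw [← Finset.card_sigma]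
  let f : ((_ : V) × V × ℤ) → ℕ × ℕ := fun p => (num p.1, num p.2.1)
  have hinj : Set.InjOn f (Finset.univ.sigma fun u => (ringProfile num u).1 :
      Finset ((_ : V) × V × ℤ)) := by
    rintro ⟨u, v, l⟩ h ⟨u', v', l'⟩ h' heq
    simp only [Finset.coe_sigma, Set.mem_sigma_iff, Finset.mem_coe, Finset.mem_univ,
      true_and] at h h'
    have h1 := buys_ring.1 h
    have h2 := buys_ring.1 h'
    simp only [f, Prod.mk.injEq] at heq
    obtain rfl : u = u' := eq_of_num heq.1
    obtain rfl : v = v' := eq_of_num heq.2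
    obtain rfl : l = l' := by unfold RingRel at h1 h2; omega
    rfl
  rw [← Finset.card_image_of_injOn hinj]
  let T : Finset (ℕ × ℕ) := ({(0, 1), (1, 2), (2, 3), (3, 0)} ∪
    (Finset.Ico 4 (Fintype.card V)).image fun i => (i, if i % 2 = 0 then 0 else 2)) ∪
    (Finset.Ico 4 (Fintype.card V)).image fun i => (if i % 2 = 0 then 2 else 0, i)
  have hT : T.card ≤ 4 + (Fintype.card V - 4) + (Fintype.card V - 4) := by
    refine (Finset.card_union_le _ _).trans (Nat.add_le_add ((Finset.card_union_le _ _).trans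
      (Nat.add_le_add Finset.card_le_four ?_)) ?_) <;>
    exact Finset.card_image_le.trans (Nat.card_Ico _ _).le
  refine (Nat.add_le_add_right (Finset.card_le_card (t := T) ?_) 4).trans (by omega)
  intro p hp
  obtain ⟨⟨u, v, l⟩, h, rfl⟩ := Finset.mem_image.1 hp
  have h1 := buys_ring.1 (Finset.mem_sigma.1 h).2
  have hu := (num u).2
  have hv := (num v).2
  simp only [T, f, Finset.mem_union, Finset.mem_image, Finset.mem_insert, Finset.mem_singleton,
    Finset.mem_Ico, Prod.mk.injEq]
  dsimp only at h1
  unfold RingRel at h1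
  rcases h1 with h | h | h | h | h | h | h | h
  · omega
  · omega
  · omega
  · omega
  · exact Or.inl (Or.inr ⟨num u, by omega, rfl, by simp [h]⟩)
  · exact Or.inr ⟨num v, by omega, by simp [h], rfl⟩
  · exact Or.inl (Or.inr ⟨num u, by omega, rfl, by simp [h]⟩)
  · exact Or.inr ⟨num v, by omega, by simp [h], rfl⟩

end Ring

/-! ### The ring profile is an equilibrium -/

section RingNash

variable {V : Type*} [Fintype V] {num : V ≃ Fin (Fintype.card V)} {u : V}

theorem num_ne {x y : V} (h : x ≠ y) : (num x : ℕ) ≠ num y := fun h' => h (eq_of_num h')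

theorem exists_num_eq_int {i : ℤ} (h0 : 0 ≤ i) (hi : i < Fintype.card V) :
    ∃ z, ((num z : ℕ) : ℤ) = i := by
  refine ⟨num.symm ⟨i.toNat, by omega⟩, ?_⟩
  simp [h0]

variable [DecidableEq V]

theorem ring_card_le (num : V ≃ Fin (Fintype.card V)) (u : V) (F : Finset V)
    (hF : ∀ v l, RingRel (Fintype.card V) (num u) (num v) l → v ∈ F) :
    (ringProfile num u).1.card ≤ F.card := by
  refine Finset.card_le_card_of_injOn Prod.fst (fun p hp => hF p.1 p.2 (buys_ring.1 hp)) ?_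
  rintro ⟨v, l⟩ h ⟨v', l'⟩ h' heq
  obtain rfl : v = v' := heq
  have h1 := buys_ring.1 (Finset.mem_coe.1 h)
  have h2 := buys_ring.1 (Finset.mem_coe.1 h')
  obtain rfl : l = l' := by unfold RingRel at h1 h2; omega
  rfl

theorem ring_devStep {S' : Strategy u} {x y : V} {l : ℤ}
    (h : DevStep (ringProfile num) u S' x y l) :
    (x = u ∧ (y, l) ∈ S'.1) ∨ (x ≠ u ∧ RingRel (Fintype.card V) (num x) (num y) l) ∨
    (y = u ∧ (x, l) ∈ S'.1) ∨ (y ≠ u ∧ RingRel (Fintype.card V) (num y) (num x) l) := by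
  rwa [DevStep, buys_ring, buys_ring] at h

/-- Without its own edges, an outer agent does not reach agent number `1`. -/
theorem ring_not_arrives_outer (hn : 4 ≤ Fintype.card V) (hu : 4 ≤ (num u : ℕ)) {S' : Strategy u}
    (hS : S'.1 = ∅) : ¬ ∀ v, v ≠ u → ∃ l, Arrives (DevStep (ringProfile num) u S') u v l := by
  intro harr
  obtain ⟨b, hb⟩ : ∃ b, (num b : ℕ) = 1 := ⟨num.symm ⟨1, by omega⟩, by simp⟩
  obtain ⟨l, hl⟩ := harr b (by rintro rfl; omega)
  -- The only edge left at `u` is the late one bought by a hub, whereas agent `1` has only the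
  -- labels `n` and `n + 1`.
  have hle := hl.le_of_start (b := Fintype.card V + 2) fun y l h => by
    rcases ring_devStep h with ⟨-, h⟩ | ⟨h, -⟩ | ⟨-, h⟩ | ⟨-, h⟩
    · simp [hS] at h
    · exact absurd rfl h
    · simp [hS] at h
    · unfold RingRel at h; omega
  obtain ⟨x, hx, -⟩ := hl.cases_last
  rcases ring_devStep hx with ⟨-, h⟩ | ⟨-, h⟩ | ⟨-, h⟩ | ⟨-, h⟩
  · simp [hS] at h
  · unfold RingRel at h; omega
  · simp [hS] at h
  · unfold RingRel at h; omega

/-- Without its own edge, agent number `1` does not reach agent number `2`, and agent number `3`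
does not reach agent number `0`. -/
theorem ring_not_arrives_mid (hn : 4 ≤ Fintype.card V) {q : ℕ}
    (hu : ((num u : ℕ) = 1 ∧ q = 2) ∨ ((num u : ℕ) = 3 ∧ q = 0)) {S' : Strategy u}
    (hS : S'.1 = ∅) : ¬ ∀ v, v ≠ u → ∃ l, Arrives (DevStep (ringProfile num) u S') u v l := by
  intro harr
  obtain ⟨c, hc⟩ : ∃ c, (num c : ℕ) = q := ⟨num.symm ⟨q, by omega⟩, by simp⟩
  obtain ⟨l, hl⟩ := harr c (by rintro rfl; omega)
  have hrel : ∀ {x y l}, DevStep (ringProfile num) u S' x y l →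
      (x ≠ u ∧ RingRel (Fintype.card V) (num x) (num y) l) ∨
      (y ≠ u ∧ RingRel (Fintype.card V) (num y) (num x) l) := by
    intro x y l h
    have h := ring_devStep h
    simpa [hS] using h
  -- The only edge left at `u` has label `n`, so every arrival is at time `n` or later. The hub `q`
  -- could then be entered only from an outer agent on its late edge, but the other edge of that
  -- agent has an early label.
  have hle : ∀ {v l}, Arrives (DevStep (ringProfile num) u S') u v l → Fintype.card V ≤ l := by
    intro v l hl
    refine hl.le_of_start fun y l h => ?_
    rcases hrel h with ⟨h, -⟩ | ⟨-, h⟩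
    · exact absurd rfl h
    · unfold RingRel at h; omega
  have hcl := hle hl
  obtain ⟨x, hx, hx'⟩ := hl.cases_last
  have hxn := (num x).2
  rcases hrel hx with ⟨hxu, h⟩ | ⟨-, h⟩
  · have := num_ne (num := num) hxu
    unfold RingRel at h; omega
  · have hxu : x ≠ u := by
      rintro rfl
      unfold RingRel at h; omega
    obtain ⟨l', hlt, hl'⟩ := hx'.resolve_left hxu
    have := hle hl'
    obtain ⟨y, hy, -⟩ := hl'.cases_last
    rcases hrel hy with ⟨-, h'⟩ | ⟨-, h'⟩ <;>
    · unfold RingRel at h h'; omega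

section Hub

variable {p q b d r : ℕ} {S' : Strategy u}

/-- A choice of one of the two hubs `p`, the other hub `q`, the other two ring agents `b` and `d`,
with `p` buying the edge to `b`, and the parity `r` of the outer agents to whom `p` buys an edge. -/
def HubData (p q b d r : ℕ) : Prop :=
  (p = 0 ∧ q = 2 ∧ b = 1 ∧ d = 3 ∧ r = 1) ∨ (p = 2 ∧ q = 0 ∧ b = 3 ∧ d = 1 ∧ r = 0)

/-- This and `HubData.ringRel_self` name the outer agent who occupies the early label `l` at each
hub; such an agent exists as long as `i < n`. -/
theorem HubData.ringRel_other (h : HubData p q b d r) {n i j : ℕ} {l : ℤ} (hl : 1 ≤ l)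
    (hi : (i : ℤ) = 2 * l + 2 + r) (hj : j = q) : RingRel n i j l := by
  rcases h with ⟨rfl, rfl, rfl, rfl, rfl⟩ | ⟨rfl, rfl, rfl, rfl, rfl⟩
  · exact .odd_two (by omega) (by omega) hj (by omega)
  · exact .even_zero (by omega) (by omega) hj (by omega)

theorem HubData.ringRel_self (h : HubData p q b d r) {n i j : ℕ} {l : ℤ} (hl : 1 ≤ l)
    (hi : (i : ℤ) = 2 * l + 3 - r) (hj : j = p) : RingRel n i j l := by
  rcases h with ⟨rfl, rfl, rfl, rfl, rfl⟩ | ⟨rfl, rfl, rfl, rfl, rfl⟩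
  · exact .even_zero (by omega) (by omega) hj (by omega)
  · exact .odd_two (by omega) (by omega) hj (by omega)

/-- A deviation `S'` of the hub `u`, numbered `p`, that is not penalized. -/
structure HubDeviation (num : V ≃ Fin (Fintype.card V)) (u : V) (S' : Strategy u)
    (p q b d r : ℕ) : Prop where
  data : HubData p q b d r
  num_eq : (num u : ℕ) = p
  pos : ∀ v l, (v, l) ∈ S'.1 → 1 ≤ l
  not_conflict : ∀ v l x w, (v, l) ∈ S'.1 → x ≠ u → Buys (ringProfile num) x w l →
    ¬ (x = v ∨ w = v ∨ w = u)

namespace HubDeviation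

/-- No early arrival at an outer agent who buys the edge to the other hub. -/
theorem not_arrives_outer (H : HubDeviation num u S' p q b d r) {x : V} {l : ℤ}
    (hx : 4 ≤ (num x : ℕ)) (hx' : (num x : ℕ) % 2 = r) (hl : 2 * l < (num x : ℕ) - 2 - r) :
    ¬ Arrives (DevStep (ringProfile num) u S') u x l := by
  intro h
  have hd := H.data
  have hu := H.num_eq
  have hxn := (num x).2
  unfold HubData at hd
  obtain ⟨y, hy, -⟩ := h.cases_last
  rcases ring_devStep hy with ⟨-, h⟩ | ⟨hyu, h⟩ | ⟨rfl, -⟩ | ⟨-, h⟩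
  · have h1 := H.pos _ _ h
    -- The outer agent `z` buys its edge to `u` with the very label `l`; the bound on `l` makes the
    -- number of `z` smaller than that of `x`.
    obtain ⟨z, hz⟩ := exists_num_eq_int (num := num) (i := 2 * l + 3 - r) (by omega) (by omega)
    exact H.not_conflict _ _ z u h (by rintro rfl; omega)
      (buys_ring.2 (H.data.ringRel_self h1 hz hu)) (Or.inr (Or.inr rfl))
  · have := num_ne (num := num) hyu
    unfold RingRel at h; omega
  · omega
  · unfold RingRel at h; omega

/-- The ways to arrive early at the other hub. -/
theorem arrives_hub (H : HubDeviation num u S' p q b d r) {c : V} {l : ℤ} (hc : (num c : ℕ) = q)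
    (hl : l ≤ Fintype.card V) (h : Arrives (DevStep (ringProfile num) u S') u c l) :
    (c, l) ∈ S'.1 ∨ (l = Fintype.card V ∧ ∃ x, (num x : ℕ) = d ∧
      ∃ l' < l, Arrives (DevStep (ringProfile num) u S') u x l') := by
  have hd := H.data
  have hu := H.num_eq
  unfold HubData at hd
  obtain ⟨x, hx, hx'⟩ := h.cases_last
  have hxn := (num x).2
  rcases ring_devStep hx with ⟨-, h⟩ | ⟨hxu, h⟩ | ⟨rfl, -⟩ | ⟨-, h⟩
  · exact Or.inl h
  · obtain ⟨l', hlt, hl'⟩ := hx'.resolve_left hxu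
    exact absurd hl' (H.not_arrives_outer (by unfold RingRel at h; omega)
      (by unfold RingRel at h; omega) (by unfold RingRel at h; omega))
  · omega
  · have hxd : (num x : ℕ) = d := by unfold RingRel at h; omega
    obtain ⟨l', hlt, hl'⟩ := hx'.resolve_left (by rintro rfl; omega)
    exact Or.inr ⟨by unfold RingRel at h; omega, x, hxd, l', hlt, hl'⟩

/-- Without a purchase by `u`, the agent `y` is entered only on its early edge to the other hub. So
`u` would have to be at that hub even earlier, through a purchase whose label another outer agent
already uses there. -/
theorem exists_buys_outer (H : HubDeviation num u S' p q b d r)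
    (harr : ∀ v, v ≠ u → ∃ l, Arrives (DevStep (ringProfile num) u S') u v l) {y : V}
    (hy : 4 ≤ (num y : ℕ)) (hy' : (num y : ℕ) % 2 = r) : ∃ l, (y, l) ∈ S'.1 := by
  have hd := H.data
  have hu := H.num_eq
  have hyn := (num y).2
  unfold HubData at hd
  obtain ⟨l, hl⟩ := harr y (by rintro rfl; omega)
  obtain ⟨x, hx, hx'⟩ := hl.cases_last
  rcases ring_devStep hx with ⟨-, h⟩ | ⟨hxu, h⟩ | ⟨rfl, -⟩ | ⟨-, h⟩
  · exact ⟨l, h⟩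
  · have := num_ne (num := num) hxu
    unfold RingRel at h; omega
  · omega
  · have hxq : (num x : ℕ) = q := by unfold RingRel at h; omega
    have hly : 2 * l = (num y : ℕ) - 2 - r := by unfold RingRel at h; omega
    obtain ⟨l', hlt, hl'⟩ := hx'.resolve_left (by rintro rfl; omega)
    rcases H.arrives_hub hxq (by omega) hl' with h1 | ⟨h1, -⟩
    · exfalso
      have h2 := H.pos _ _ h1
      obtain ⟨z, hz⟩ := exists_num_eq_int (num := num) (i := 2 * l' + 2 + r) (by omega) (by omega)
      exact H.not_conflict _ _ z x h1 (by rintro rfl; omega)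
        (buys_ring.2 (H.data.ringRel_other h2 hz hxq)) (Or.inr (Or.inl rfl))
    · omega

/-- Otherwise agent `b` could be reached only through its edge to the other hub, with label `n + 1`.
That hub would have to be entered from `d` at time `n`, but the edges of `d` in the profile have
labels `n` and `n + 1`, so none leads to `d` in time. -/
theorem exists_buys_ring (hn : 4 ≤ Fintype.card V) (H : HubDeviation num u S' p q b d r)
    (harr : ∀ v, v ≠ u → ∃ l, Arrives (DevStep (ringProfile num) u S') u v l) :
    ∃ v l, (v, l) ∈ S'.1 ∧ ¬ (4 ≤ (num v : ℕ) ∧ (num v : ℕ) % 2 = r) := by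
  by_contra! hS
  have hd := H.data
  have hu := H.num_eq
  unfold HubData at hd
  have hout : ∀ {v l}, (v, l) ∈ S'.1 → 4 ≤ (num v : ℕ) := fun {v l} h => by
    have := hS v l h
    tauto
  obtain ⟨y, hy⟩ : ∃ y, (num y : ℕ) = b := ⟨num.symm ⟨b, by omega⟩, by simp⟩
  obtain ⟨l, hl⟩ := harr y (by rintro rfl; omega)
  obtain ⟨x, hx, hx'⟩ := hl.cases_last
  rcases ring_devStep hx with ⟨-, h⟩ | ⟨hxu, h⟩ | ⟨rfl, -⟩ | ⟨-, h⟩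
  · have := hout h
    omega
  · have := num_ne (num := num) hxu
    unfold RingRel at h; omega
  · omega
  · have hxq : (num x : ℕ) = q := by unfold RingRel at h; omega
    have hln : l = Fintype.card V + 1 := by unfold RingRel at h; omega
    obtain ⟨l', hlt, hl'⟩ := hx'.resolve_left (by rintro rfl; omega)
    rcases H.arrives_hub hxq (by omega) hl' with h1 | ⟨h1, z, hz, l'', hlt'', hl''⟩
    · have := hout h1
      omega
    · obtain ⟨w, hw, -⟩ := hl''.cases_last
      rcases ring_devStep hw with ⟨-, h⟩ | ⟨hwu, h⟩ | ⟨rfl, -⟩ | ⟨-, h⟩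
      · have := hout h
        omega
      · unfold RingRel at h; omega
      · omega
      · unfold RingRel at h; omega

theorem card_le (hn : 4 ≤ Fintype.card V) (H : HubDeviation num u S' p q b d r)
    (harr : ∀ v, v ≠ u → ∃ l, Arrives (DevStep (ringProfile num) u S') u v l) :
    (ringProfile num u).1.card ≤ S'.1.card := by
  have hd := H.data
  have hu := H.num_eq
  unfold HubData at hd
  obtain ⟨y, hy⟩ : ∃ y, (num y : ℕ) = b := ⟨num.symm ⟨b, by omega⟩, by simp⟩
  set O : Finset V := Finset.univ.filter fun v => 4 ≤ (num v : ℕ) ∧ (num v : ℕ) % 2 = r with hO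
  obtain ⟨w, l, hw, hwO⟩ := H.exists_buys_ring hn harr
  have hwO' : w ∉ O := by simpa [hO] using hwO
  have h1 : (ringProfile num u).1.card ≤ O.card + 1 := by
    refine (ring_card_le num u (insert y O) fun v l h => ?_).trans (Finset.card_insert_le _ _)
    rw [Finset.mem_insert, hO, Finset.mem_filter]
    by_cases hv : (num v : ℕ) = b
    · exact Or.inl (eq_of_num (num := num) (by omega))
    · exact Or.inr ⟨Finset.mem_univ v, by unfold RingRel at h; omega⟩
  have h2 : insert w O ⊆ S'.1.image Prod.fst := by
    intro v hv
    rw [Finset.mem_image]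
    rcases Finset.mem_insert.1 hv with rfl | hv
    · exact ⟨_, hw, rfl⟩
    · rw [hO, Finset.mem_filter] at hv
      obtain ⟨l, hl⟩ := H.exists_buys_outer harr hv.2.1 hv.2.2
      exact ⟨_, hl, rfl⟩
  have h3 := (Finset.card_le_card h2).trans Finset.card_image_le
  rw [Finset.card_insert_of_notMem hwO'] at h3
  omega

end HubDeviation

end Hub

theorem ring_isNash {K : ℝ} (hK : (Fintype.card V : ℝ) ≤ K) (hn : 4 ≤ Fintype.card V)
    (num : V ≃ Fin (Fintype.card V)) : IsNash K (ringProfile num) := by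
  refine isNash_of_forall (ring_cost K hn num) (fun u => ?_)
    fun u S' hlt hpos hconf harr => ?_
  · refine le_trans ?_ hK
    exact_mod_cast ring_card_le num u Finset.univ fun v l _ => Finset.mem_univ v
  -- Whoever buys at most one edge can save only by buying nothing.
  have hempty : ∀ v, (∀ w l, RingRel (Fintype.card V) (num u) (num w) l → (num w : ℕ) = num v) →
      S'.1 = ∅ := by
    intro v hv
    have := ring_card_le num u {v} fun w l h => Finset.mem_singleton.2 (eq_of_num (hv w l h))
    rw [Finset.card_singleton] at this
    exact Finset.card_eq_zero.1 (by omega)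
  obtain ⟨a, ha⟩ : ∃ a, (num a : ℕ) = 0 := ⟨num.symm ⟨0, by omega⟩, by simp⟩
  obtain ⟨c, hc⟩ : ∃ c, (num c : ℕ) = 2 := ⟨num.symm ⟨2, by omega⟩, by simp⟩
  by_cases h0 : (num u : ℕ) = 0
  · have := (HubDeviation.mk (Or.inl ⟨rfl, rfl, rfl, rfl, rfl⟩) h0 hpos hconf).card_le hn harr
    omega
  by_cases h2 : (num u : ℕ) = 2
  · have := (HubDeviation.mk (Or.inr ⟨rfl, rfl, rfl, rfl, rfl⟩) h2 hpos hconf).card_le hn harr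
    omega
  by_cases h1 : (num u : ℕ) = 1
  · exact ring_not_arrives_mid hn (Or.inl ⟨h1, rfl⟩)
      (hempty c fun w l h => by unfold RingRel at h; omega) harr
  by_cases h3 : (num u : ℕ) = 3
  · exact ring_not_arrives_mid hn (Or.inr ⟨h3, rfl⟩)
      (hempty a fun w l h => by unfold RingRel at h; omega) harr
  by_cases h4 : (num u : ℕ) % 2 = 0
  · exact ring_not_arrives_outer hn (by omega)
      (hempty a fun w l h => by unfold RingRel at h; omega) harr
  · exact ring_not_arrives_outer hn (by omega)
      (hempty c fun w l h => by unfold RingRel at h; omega) harr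

end RingNash

/-! ### At most three agents -/

section Small

variable {V : Type*} [Fintype V] {num : V ≃ Fin (Fintype.card V)} {u : V}

/-- For at most three agents: agent `i` buys the edge to every agent `j > i`, with label
`4 - i - j`. -/
noncomputable def smallProfile (num : V ≃ Fin (Fintype.card V)) : Profile V := fun u =>
  ⟨(Finset.univ.filter fun v => num u < num v).map
    ⟨fun v => (v, 4 - ((num u : ℕ) : ℤ) - (num v : ℕ)), fun _ _ h => (Prod.mk.inj h).1⟩, by
    intro p hp h
    rw [Finset.mem_map] at hp
    obtain ⟨v, hv, rfl⟩ := hp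
    rw [Finset.mem_filter] at hv
    exact absurd hv.2 (by rw [show v = u from h]; exact lt_irrefl _)⟩

theorem buys_small {v : V} {l : ℤ} : Buys (smallProfile num) u v l ↔
    (num u : ℕ) < num v ∧ l = 4 - (num u : ℕ) - (num v : ℕ) := by
  unfold Buys smallProfile
  simp only [Finset.mem_map, Finset.mem_filter, Finset.mem_univ, true_and]
  constructor
  · rintro ⟨w, hw, h⟩
    obtain ⟨rfl, rfl⟩ := Prod.mk.inj h
    exact ⟨hw, rfl⟩
  · rintro ⟨hv, rfl⟩
    exact ⟨v, hv, rfl⟩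

theorem small_card (num : V ≃ Fin (Fintype.card V)) (u : V) :
    (smallProfile num u).1.card = Fintype.card V - 1 - num u := by
  unfold smallProfile
  rw [Finset.card_map, ← Fin.card_Ioi]
  refine Finset.card_bij (fun v _ => num v) (by simp) (by simp) fun i hi => ?_
  exact ⟨num.symm i, by simpa using hi, by simp⟩

theorem small_sum_card (hn : Fintype.card V ≤ 3) (num : V ≃ Fin (Fintype.card V)) :
    ∑ u, (smallProfile num u).1.card = 2 * Fintype.card V - 3 := by
  simp_rw [small_card]
  rw [Equiv.sum_comp num fun i => Fintype.card V - 1 - (i : ℕ)]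
  generalize Fintype.card V = n at hn
  interval_cases n <;> rfl

theorem small_cost (K : ℝ) (hn : Fintype.card V ≤ 3) (num : V ≃ Fin (Fintype.card V)) (u : V) :
    cost K (smallProfile num) u = (smallProfile num u).1.card := by
  refine cost_eq_card K (fun v l h => ?_) (fun v w l h h' => ?_) (fun v l x w h hx h' => ?_) ?_
  · rw [buys_small] at h
    omega
  · rw [buys_small] at h h'
    exact eq_of_num (num := num) (by omega)
  · rw [buys_small] at h h'
    have := num_ne (num := num) hx
    omega
  · rw [Set.eq_univ_iff_forall]
    intro v
    have hcase := lt_trichotomy (num u : ℕ) (num v)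
    have hstep : v ≠ u → (temporalGraph (smallProfile num)).Step u v (4 - (num u : ℕ) - (num v : ℕ)) := by
      intro hvu
      have := num_ne (num := num) hvu
      refine label_eq_of_buys (fun l' h' => ?_) ?_
      · rw [buys_small, buys_small] at h'
        omega
      · rw [buys_small, buys_small]
        rcases hcase with h | h | h
        · exact Or.inl ⟨h, rfl⟩
        · exact absurd h.symm this
        · exact Or.inr ⟨h, by omega⟩
    rcases eq_or_ne v u with rfl | hvu
    · exact (AtBefore.refl _ v 0).mem_strictReach
    · exact (Arrives.one (hstep hvu)).mem_strictReach

theorem small_devStep {S' : Strategy u} {x y : V} {l : ℤ}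
    (h : DevStep (smallProfile num) u S' x y l) :
    (x = u ∧ (y, l) ∈ S'.1) ∨
    (x ≠ u ∧ (num x : ℕ) < num y ∧ l = 4 - (num x : ℕ) - (num y : ℕ)) ∨
    (y = u ∧ (x, l) ∈ S'.1) ∨
    (y ≠ u ∧ (num y : ℕ) < num x ∧ l = 4 - (num y : ℕ) - (num x : ℕ)) := by
  rwa [DevStep, buys_small, buys_small] at h

/-- With three agents the edges 01, 02, 12 have labels 3, 2, 1. Agent 0 cannot go on along 12 after
a step with a positive label, so it needs both of its edges. Agent 1 without its edge starts with
label 3, too late for 02. Agent 2 buys nothing. -/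
theorem small_isNash [DecidableEq V] {K : ℝ} (hK : (Fintype.card V : ℝ) ≤ K)
    (hn : Fintype.card V ≤ 3) (num : V ≃ Fin (Fintype.card V)) : IsNash K (smallProfile num) := by
  refine isNash_of_forall (small_cost K hn num) (fun u => ?_) fun u S' hlt hpos _ harr => ?_
  · refine le_trans ?_ hK
    rw [small_card]
    exact_mod_cast (by omega)
  rw [small_card] at hlt
  by_cases h0 : (num u : ℕ) = 0
  · have hle : ∀ {v l}, Arrives (DevStep (smallProfile num) u S') u v l → 1 ≤ l := by
      intro v l hl
      refine hl.le_of_start fun y l h => ?_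
      rcases small_devStep h with ⟨-, h⟩ | ⟨h, -⟩ | ⟨rfl, h⟩ | ⟨-, h⟩
      · exact hpos _ _ h
      · exact absurd rfl h
      · exact absurd rfl (S'.2 _ h)
      · omega
    have hsub : Finset.univ.erase u ⊆ S'.1.image Prod.fst := by
      intro y hy
      have hyu := Finset.ne_of_mem_erase hy
      obtain ⟨l, hl⟩ := harr y hyu
      obtain ⟨x, hx, hx'⟩ := hl.cases_last
      have hxn := (num x).2
      have hyn := (num y).2
      have hyu' := num_ne (num := num) hyu
      rcases small_devStep hx with ⟨-, h⟩ | ⟨hxu, h⟩ | ⟨h, -⟩ | ⟨-, h⟩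
      · exact Finset.mem_image.2 ⟨_, h, rfl⟩
      · have := num_ne (num := num) hxu
        obtain ⟨l', hlt', hl'⟩ := hx'.resolve_left hxu
        have := hle hl'
        omega
      · exact absurd h hyu
      · obtain ⟨l', hlt', hl'⟩ := hx'.resolve_left (by rintro rfl; omega)
        have := hle hl'
        omega
    have := (Finset.card_le_card hsub).trans Finset.card_image_le
    rw [Finset.card_erase_of_mem (Finset.mem_univ u), Finset.card_univ] at this
    omega
  · have hS : S'.1 = ∅ := Finset.card_eq_zero.1 (by omega)
    obtain ⟨c, hc⟩ : ∃ c, (num c : ℕ) = 2 := ⟨num.symm ⟨2, by omega⟩, by simp⟩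
    obtain ⟨l, hl⟩ := harr c (by rintro rfl; omega)
    have hle := hl.le_of_start (b := 3) fun y l h => by
      rcases small_devStep h with ⟨-, h⟩ | ⟨h, -⟩ | ⟨-, h⟩ | ⟨-, h⟩
      · simp [hS] at h
      · exact absurd rfl h
      · simp [hS] at h
      · omega
    obtain ⟨x, hx, -⟩ := hl.cases_last
    rcases small_devStep hx with ⟨-, h⟩ | ⟨-, h⟩ | ⟨-, h⟩ | ⟨-, h⟩
    · simp [hS] at h
    · omega
    · simp [hS] at h
    · omega

end Small

/-! ### Optimality and the price of stability -/

section Main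

variable {V : Type*} [Fintype V]

theorem socialCost_eq_of_cost {K : ℝ} {s : Profile V} (h : ∀ u, cost K s u = (s u).1.card) :
    socialCost K s = (∑ u, (s u).1.card : ℕ) := by
  rw [socialCost, Finset.sum_congr rfl fun u _ => h u, Nat.cast_sum]

theorem exists_isNash_isOptimal_of_le_three [DecidableEq V] {K : ℝ}
    (hK : (Fintype.card V : ℝ) ≤ K) (hn : Fintype.card V ≤ 3) :
    ∃ s : Profile V, IsNash K s ∧ IsOptimal K s := by
  let num := Fintype.equivFin V
  refine ⟨smallProfile num, small_isNash hK hn num, fun s' => ?_⟩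
  rcases isEmpty_or_nonempty V with hV | hV
  · simp [socialCost]
  have hK1 : 1 ≤ K := le_trans (by exact_mod_cast Fintype.card_pos) hK
  rw [socialCost_eq_of_cost (small_cost K hn num), small_sum_card hn num]
  rcases Nat.lt_or_ge (Fintype.card V) 2 with h | h
  · rw [show 2 * Fintype.card V - 3 = 0 by omega, Nat.cast_zero]
    exact Finset.sum_nonneg fun u _ => le_trans (by positivity) (le_cost hK1 s' u)
  · have := (two_mul_card_le_socialCost hK1 s').2 hn
    rw [Nat.cast_sub (by omega)]
    push_cast
    exact this

/-- The edges are squeezed between the gossip bound, with no unreached pairs, and the number of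
purchases. -/
theorem ring_sum_card_eq (hn : 4 ≤ Fintype.card V) [DecidableEq V]
    (num : V ≃ Fin (Fintype.card V)) :
    ∑ u, (ringProfile num u).1.card = 2 * Fintype.card V - 4 ∧
    (temporalGraph (ringProfile num)).graph.edgeSet.ncard = 2 * Fintype.card V - 4 := by
  have h1 := ring_sum_card hn num
  have h2 := ncard_edgeSet_le (ringProfile num)
  have h3 := (temporalGraph (ringProfile num)).two_mul_card_le.1
  rw [Finset.sum_eq_zero fun u _ => by rw [ring_isTemporallyConnected hn num u]; simp] at h3
  omega

theorem ring_socialCost (K : ℝ) (hn : 4 ≤ Fintype.card V) [DecidableEq V]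
    (num : V ≃ Fin (Fintype.card V)) :
    socialCost K (ringProfile num) = 2 * (Fintype.card V : ℝ) - 4 := by
  rw [socialCost_eq_of_cost (ring_cost K hn num), (ring_sum_card_eq hn num).1,
    Nat.cast_sub (by omega)]
  push_cast
  rfl

theorem ring_isOptimal {K : ℝ} (hK : (Fintype.card V : ℝ) ≤ K) (hn : 4 ≤ Fintype.card V)
    [DecidableEq V] (num : V ≃ Fin (Fintype.card V)) : IsOptimal K (ringProfile num) := by
  intro s'
  rw [ring_socialCost K hn num]
  refine (two_mul_card_le_socialCost (le_trans ?_ hK) s').1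
  exact_mod_cast (by omega)

theorem socialCost_pos {K : ℝ} (hK : (Fintype.card V : ℝ) ≤ K) (hn : 2 ≤ Fintype.card V)
    (s : Profile V) : 0 < socialCost K s := by
  have hn' : (2 : ℝ) ≤ Fintype.card V := by exact_mod_cast hn
  have h := two_mul_card_le_socialCost (by linarith) s
  rcases Nat.lt_or_ge 3 (Fintype.card V) with h3 | h3
  · have : (4 : ℝ) ≤ Fintype.card V := by exact_mod_cast h3
    linarith [h.1]
  · linarith [h.2 h3]

theorem exists_isNash_isOptimal [DecidableEq V] {K : ℝ} (hK : (Fintype.card V : ℝ) ≤ K) :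
    ∃ s : Profile V, IsNash K s ∧ IsOptimal K s := by
  rcases Nat.lt_or_ge 3 (Fintype.card V) with hn | hn
  · exact ⟨_, ring_isNash hK hn (Fintype.equivFin V), ring_isOptimal hK hn (Fintype.equivFin V)⟩
  · exact exists_isNash_isOptimal_of_le_three hK hn

theorem priceOfStability_eq_one [DecidableEq V] {K : ℝ} {s : Profile V} (hs : IsNash K s)
    (hopt : IsOptimal K s) (hpos : 0 < socialCost K s) : priceOfStability V K = 1 := by
  have h1 : IsLeast (socialCost K '' {s : Profile V | IsNash K s}) (socialCost K s) :=
    ⟨⟨s, hs, rfl⟩, by rintro _ ⟨s', -, rfl⟩; exact hopt s'⟩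
  have h2 : IsLeast (Set.range (socialCost K : Profile V → ℝ)) (socialCost K s) :=
    ⟨⟨s, rfl⟩, by rintro _ ⟨s', rfl⟩; exact hopt s'⟩
  rw [priceOfStability, h1.csInf_eq, h2.csInf_eq, div_self hpos.ne']

end Main

end TemporalGame

theorem mainTheorem6 {V : Type*} [Fintype V] [DecidableEq V]
    (K : ℝ) (hK : (Fintype.card V : ℝ) ≤ K) :
    (4 ≤ Fintype.card V → ∀ num : V ≃ Fin (Fintype.card V),
      (TemporalGame.temporalGraph (TemporalGame.ringProfile num)).IsProper ∧
      (TemporalGame.temporalGraph (TemporalGame.ringProfile num)).IsTemporallyConnected ∧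
      (TemporalGame.temporalGraph (TemporalGame.ringProfile num)).graph.edgeSet.ncard
        = 2 * Fintype.card V - 4 ∧
      TemporalGame.IsNash K (TemporalGame.ringProfile num) ∧
      TemporalGame.IsOptimal K (TemporalGame.ringProfile num) ∧
      TemporalGame.socialCost K (TemporalGame.ringProfile num)
        = 2 * (Fintype.card V : ℝ) - 4) ∧
    (∃ s : TemporalGame.Profile V, TemporalGame.IsNash K s ∧ TemporalGame.IsOptimal K s) ∧
    (2 ≤ Fintype.card V →
      (∀ s : TemporalGame.Profile V, 0 < TemporalGame.socialCost K s) ∧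
      TemporalGame.priceOfStability V K = 1) := by
  have hex := TemporalGame.exists_isNash_isOptimal hK
  refine ⟨fun hn num => ⟨TemporalGame.ring_isProper num,
    TemporalGame.ring_isTemporallyConnected hn num, (TemporalGame.ring_sum_card_eq hn num).2,
    TemporalGame.ring_isNash hK hn num, TemporalGame.ring_isOptimal hK hn num,
    TemporalGame.ring_socialCost K hn num⟩, hex,
    fun hn => ⟨TemporalGame.socialCost_pos hK hn, ?_⟩⟩
  obtain ⟨s, hs, hopt⟩ := hex
  exact TemporalGame.priceOfStability_eq_one hs hopt (TemporalGame.socialCost_pos hK hn s)
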